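/- Let $\mathbb{T}$ be the unit circle with normalized arc length, $L^2=L^2(\mathbb{T})$, $L^\infty=L^\infty(\mathbb{T})$, let $P_+$ be the orthogonal projection of $L^2$ onto the Hardy space $H^2$, and let $P_-=I-P_+$. For $H=\begin{pmatrix} f&\phi\\ g&\psi\end{pmatrix}$ with entries in $L^\infty$, the generalized singular integral operator with symbol $H$ is the operator $$R_H=P_+fP_++P_-gP_++P_+\phi P_-+P_-\psi P_-$$ on $L^2$. Let $QC=(H^\infty+C(\mathbb{T}))\cap\overline{(H^\infty+C(\mathbb{T}))}$ be the algebra of quasicontinuous functions, and let $\mathfrak{R}_{QC}$ be the operator norm closure of the set of finite sums of finite products of operators $R_H$ with $H\in QC_{2\times2}$; it is a $C^*$-algebra. Let $\mathcal{K}$ be the set of compact operators on $L^2$, let $\|T\|_e=\inf_{K\in\mathcal{K}}\|T-K\|$, and let $\sigma_e(T)$ be the set of all $\lambda\in\mathbb{C}$ such that $T-\lambda I$ is not Fredholm. Let $k_z(\omega)=\sqrt{1-|z|^2}/(1-\bar z\omega)$ for $|z|<1$, and let $\bar\omega\overline{k_z}$ denote the function $\omega\mapsto\bar\omega\,\overline{k_z(\omega)}$.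 1. For every $T\in\mathfrak{R}_{QC}$ the limits $$\rho(T)(\xi)=\Big(\lim_{r\to1^-}\langle Tk_{r\xi},k_{r\xi}\rangle,\ \lim_{r\to1^-}\langle T(\bar\omega\overline{k_{r\xi}}),\bar\omega\overline{k_{r\xi}}\rangle\Big)$$ exist for almost every $\xi\in\mathbb{T}$, and $\rho$ is a unital $*$-homomorphism from $\mathfrak{R}_{QC}$ to $L^\infty\times L^\infty$ with range $QC\times QC$. Moreover $\mathcal{K}\subset\mathfrak{R}_{QC}$ and $\ker\rho=\mathcal{K}$, so that $$0\longrightarrow\mathcal{K}\longrightarrow\mathfrak{R}_{QC}\overset{\rho}{\longrightarrow}QC\times QC\longrightarrow0$$ is exact, and $\|\rho(T)\|=\|T\|_e$ for every $T\in\mathfrak{R}_{QC}$, where $\|(a,b)\|=\max\{\|a\|_\infty,\|b\|_\infty\}$. 2. For every $H=\begin{pmatrix} f&\phi\\ g&\psi\end{pmatrix}\in QC_{2\times2}$: $$\|R_H\|_e=\max\{\|f\|_\infty,\|\psi\|_\infty\},\qquad \sigma_e(R_H)=\mathrm{Ran}_{ess}f\cup\mathrm{Ran}_{ess}\psi,$$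 where $\mathrm{Ran}_{ess}$ denotes the essential range, and $R_H$ is Fredholm if and only if $f$ and $\psi$ are both invertible in $QC$. -/

import Mathlib

open MeasureTheory AddCircle Filter
open scoped ENNReal Topology ComplexConjugate

noncomputable section

namespace GSIO

instance factTwoPiPos : Fact (0 < 2 * Real.pi) := ⟨Real.two_pi_pos⟩

/-- The unit circle, parametrised by `θ ↦ e^{iθ}`, `θ ∈ ℝ / 2πℤ`. -/
abbrev Torus : Type := AddCircle (2 * Real.pi)

/-- Normalised arc length on the unit circle. -/
abbrev arcLength : Measure Torus := haarAddCircle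

/-- `L²` of the circle. -/
abbrev L2 : Type := Lp ℂ 2 arcLength

/-- `L^∞` of the circle, with the essential supremum norm. -/
abbrev Linf : Type := Lp ℂ ∞ arcLength

/-- Bounded operators on `L²`, with the operator norm. -/
abbrev BL2 : Type := L2 →L[ℂ] L2

/-! ### `L^∞` as a commutative star algebra, with pointwise operations -/

instance : Mul Linf := ⟨fun f g => f • g⟩

instance : One Linf := ⟨MemLp.toLp (fun _ => (1 : ℂ)) (memLp_const 1)⟩

theorem coeFn_mul (f g : Linf) : ⇑(f * g) =ᵐ[arcLength] fun t => f t * g t :=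
  Lp.coeFn_lpSMul (r := ∞) f g

theorem coeFn_one : ⇑(1 : Linf) =ᵐ[arcLength] fun _ => (1 : ℂ) :=
  MemLp.coeFn_toLp _

theorem coeFn_star (f : Linf) : ⇑(star f) =ᵐ[arcLength] fun t => conj (f t) :=
  Lp.coeFn_star f

theorem linf_mul_comm (f g : Linf) : f * g = g * f := by
  apply Lp.ext
  filter_upwards [coeFn_mul f g, coeFn_mul g f] with t h₁ h₂
  rw [h₁, h₂, mul_comm]

theorem linf_one_mul (f : Linf) : 1 * f = f := by
  apply Lp.ext
  filter_upwards [coeFn_mul 1 f, coeFn_one] with t h₁ h₂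
  rw [h₁, h₂, one_mul]

theorem linf_mul_assoc (f g h : Linf) : f * g * h = f * (g * h) := by
  apply Lp.ext
  filter_upwards [coeFn_mul (f * g) h, coeFn_mul f g, coeFn_mul f (g * h), coeFn_mul g h]
    with t h₁ h₂ h₃ h₄
  rw [h₁, h₂, h₃, h₄, mul_assoc]

theorem linf_mul_add (f g h : Linf) : f * (g + h) = f * g + f * h := by
  apply Lp.ext
  filter_upwards [coeFn_mul f (g + h), Lp.coeFn_add g h, Lp.coeFn_add (f * g) (f * h),
    coeFn_mul f g, coeFn_mul f h] with t h₁ h₂ h₃ h₄ h₅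
  rw [h₁, h₂, h₃, Pi.add_apply, Pi.add_apply, h₄, h₅, mul_add]

theorem linf_mul_zero (f : Linf) : f * 0 = 0 := by
  have h := linf_mul_add f 0 0
  rwa [add_zero, left_eq_add] at h

instance : CommRing Linf :=
  { (inferInstance : AddCommGroup Linf) with
    mul := (· * ·)
    one := 1
    mul_comm := linf_mul_comm
    mul_assoc := linf_mul_assoc
    one_mul := linf_one_mul
    mul_one := fun f => by rw [linf_mul_comm, linf_one_mul]
    left_distrib := linf_mul_add
    right_distrib := fun f g h => by
      rw [linf_mul_comm, linf_mul_add, linf_mul_comm h f, linf_mul_comm h g]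
    zero_mul := fun f => by rw [linf_mul_comm, linf_mul_zero]
    mul_zero := linf_mul_zero }

theorem linf_smul_mul (c : ℂ) (f g : Linf) : c • f * g = c • (f * g) := by
  apply Lp.ext
  filter_upwards [coeFn_mul (c • f) g, coeFn_mul f g, Lp.coeFn_smul c f, Lp.coeFn_smul c (f * g)]
    with t h₁ h₂ h₃ h₄
  rw [h₁, h₄, h₃, Pi.smul_apply, Pi.smul_apply, h₂, smul_mul_assoc]

instance : Algebra ℂ Linf :=
  Algebra.ofModule linf_smul_mul
    (fun c f g => by rw [linf_mul_comm, linf_smul_mul, linf_mul_comm g f])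

instance : StarRing Linf where
  star_mul f g := by
    apply Lp.ext
    filter_upwards [coeFn_star (f * g), coeFn_mul f g, coeFn_mul (star g) (star f),
      coeFn_star f, coeFn_star g] with t h₁ h₂ h₃ h₄ h₅
    rw [h₁, h₂, h₃, h₄, h₅, map_mul, mul_comm]
  star_add f g := by
    apply Lp.ext
    filter_upwards [coeFn_star (f + g), Lp.coeFn_add f g, Lp.coeFn_add (star f) (star g),
      coeFn_star f, coeFn_star g] with t h₁ h₂ h₃ h₄ h₅
    rw [h₁, h₂, h₃, Pi.add_apply, Pi.add_apply, h₄, h₅, map_add]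

/-! ### Generalized singular integral operators -/

/-- The multiplication operator `x ↦ f x` on `L²`. -/
def mulOp (f : Linf) : BL2 :=
  (ContinuousLinearMap.mul ℂ ℂ).holderL arcLength ∞ 2 2 f

theorem coeFn_mulOp (f : Linf) (x : L2) : ⇑(mulOp f x) =ᵐ[arcLength] fun t => f t * x t :=
  (ContinuousLinearMap.mul ℂ ℂ).coeFn_holder f x

/-- The Hardy space `H²`: the closed linear span in `L²` of `e^{inθ}`, `n ≥ 0`. -/
def hardy : Submodule ℂ L2 :=
  (Submodule.span ℂ {x : L2 | ∃ n : ℤ, 0 ≤ n ∧ x = fourierLp 2 n}).topologicalClosure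

instance : CompleteSpace hardy :=
  (Submodule.isClosed_topologicalClosure _).completeSpace_coe

/-- The Riesz projection: the orthogonal projection of `L²` onto `H²`. -/
def Pplus : BL2 := hardy.starProjection

/-- `P₋ = I - P₊`. -/
def Pminus : BL2 := 1 - Pplus

/-- The operator `R_H = P₊ f P₊ + P₋ g P₊ + P₊ φ P₋ + P₋ ψ P₋` with symbol
`H = !![f, φ; g, ψ]`. -/
def gsio (H : Matrix (Fin 2) (Fin 2) Linf) : BL2 :=
  Pplus * mulOp (H 0 0) * Pplus + Pminus * mulOp (H 1 0) * Pplus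
    + Pplus * mulOp (H 0 1) * Pminus + Pminus * mulOp (H 1 1) * Pminus

/-! ### Quasicontinuous functions -/

/-- `H^∞`: the bounded functions whose Fourier coefficients of negative index vanish. -/
def Hinf : Set Linf := {f | ∀ n : ℤ, n < 0 → fourierCoeff f n = 0}

/-- `C(𝕋)` inside `L^∞`. -/
def contFun : Set Linf := {f | ∃ c : C(Torus, ℂ), ⇑f =ᵐ[arcLength] c}

/-- `H^∞ + C(𝕋)`. -/
def HinfPlusC : Set Linf := {f | ∃ h ∈ Hinf, ∃ c ∈ contFun, f = h + c}

/-- `QC`: the functions `f` such that both `f` and its complex conjugate are in `H^∞ + C(𝕋)`. -/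
def QC : Set Linf := {f | f ∈ HinfPlusC ∧ star f ∈ HinfPlusC}

/-- `f` is invertible in `QC`: it is in `QC` and has a multiplicative inverse in `QC`. -/
def InvertibleInQC (f : Linf) : Prop := f ∈ QC ∧ ∃ h ∈ QC, f * h = 1

/-- The generalized singular integral operators with symbol in `QC_{2×2}`. -/
def gsioQC : Set BL2 := {T | ∃ H : Matrix (Fin 2) (Fin 2) Linf, (∀ i j, H i j ∈ QC) ∧ T = gsio H}

/-! ### The `C*`-algebra generated by them -/

theorem star_mem_QC {f : Linf} (hf : f ∈ QC) : star f ∈ QC :=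
  ⟨hf.2, by rw [star_star]; exact hf.1⟩

theorem zero_mem_Hinf : (0 : Linf) ∈ Hinf := by
  intro n _
  have h : ⇑(0 : Linf) =ᵐ[arcLength] 0 := Lp.coeFn_zero _ _ _
  unfold fourierCoeff
  rw [integral_eq_zero_of_ae]
  filter_upwards [h] with t ht
  rw [ht]
  simp

theorem contFun_subset : contFun ⊆ HinfPlusC := fun f hf =>
  ⟨0, zero_mem_Hinf, f, hf, (zero_add f).symm⟩

theorem star_mem_contFun {f : Linf} (hf : f ∈ contFun) : star f ∈ contFun := by
  obtain ⟨c, hc⟩ := hf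
  refine ⟨star c, ?_⟩
  filter_upwards [coeFn_star f, hc] with t h₁ h₂
  rw [h₁, h₂]
  rfl

theorem contFun_subset_QC : contFun ⊆ QC := fun _ hf =>
  ⟨contFun_subset hf, contFun_subset (star_mem_contFun hf)⟩

theorem const_mem_contFun (c : ℂ) : c • (1 : Linf) ∈ contFun := by
  refine ⟨ContinuousMap.const _ c, ?_⟩
  filter_upwards [Lp.coeFn_smul c (1 : Linf), coeFn_one] with t h₁ h₂
  rw [h₁, Pi.smul_apply, h₂]
  simp

theorem mulOp_smul_one (c : ℂ) : mulOp (c • (1 : Linf)) = c • (1 : BL2) := by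
  ext1 x
  apply Lp.ext
  filter_upwards [coeFn_mulOp (c • 1) x, Lp.coeFn_smul c (1 : Linf), coeFn_one,
    Lp.coeFn_smul c x] with t h₁ h₂ h₃ h₄
  rw [h₁, h₂, Pi.smul_apply, h₃]
  change _ = (c • x : L2) t
  rw [h₄]
  simp

theorem mulOp_zero : mulOp 0 = 0 := by
  unfold mulOp
  rw [map_zero]

theorem star_mulOp (f : Linf) : star (mulOp f) = mulOp (star f) := by
  rw [ContinuousLinearMap.star_eq_adjoint, eq_comm, ContinuousLinearMap.eq_adjoint_iff]
  intro x y
  rw [L2.inner_def, L2.inner_def]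
  apply integral_congr_ae
  filter_upwards [coeFn_mulOp (star f) x, coeFn_mulOp f y, coeFn_star f] with t h₁ h₂ h₃
  rw [h₁, h₂, h₃]
  simp only [RCLike.inner_apply, map_mul, Complex.conj_conj]
  ring

theorem star_Pplus : star Pplus = Pplus :=
  (isSelfAdjoint_starProjection hardy)

theorem star_Pminus : star Pminus = Pminus := by
  rw [Pminus, star_sub, star_one, star_Pplus]

theorem Pplus_mul_Pplus : Pplus * Pplus = Pplus :=
  hardy.isIdempotentElem_starProjection

theorem smul_one_mem_gsioQC (c : ℂ) : c • (1 : BL2) ∈ gsioQC := by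
  have h₀ : (0 : Linf) ∈ QC := by
    have := contFun_subset_QC (const_mem_contFun 0)
    rwa [zero_smul] at this
  refine ⟨!![c • 1, 0; 0, c • 1], ?_, ?_⟩
  · intro i j
    fin_cases i <;> fin_cases j
    · exact contFun_subset_QC (const_mem_contFun c)
    · exact h₀
    · exact h₀
    · exact contFun_subset_QC (const_mem_contFun c)
  · have h : Pminus * Pminus = Pminus := by
      simp only [Pminus, sub_mul, mul_sub, one_mul, mul_one, Pplus_mul_Pplus, sub_self, sub_zero]
    simp only [gsio, Matrix.of_apply, Matrix.cons_val', Matrix.cons_val_zero, Matrix.cons_val_one,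
      Matrix.cons_val_fin_one, mulOp_smul_one, mulOp_zero, mul_zero, zero_mul, add_zero,
      mul_smul_comm, smul_mul_assoc, mul_one, Pplus_mul_Pplus, h]
    rw [← smul_add, Pminus, add_sub_cancel]

theorem star_mem_gsioQC {T : BL2} (hT : T ∈ gsioQC) : star T ∈ gsioQC := by
  obtain ⟨H, hH, rfl⟩ := hT
  refine ⟨fun i j => star (H j i), fun i j => star_mem_QC (hH j i), ?_⟩
  simp only [gsio, star_add, star_mul, star_mulOp, star_Pplus, star_Pminus, mul_assoc]
  abel

theorem star_mem_closure {T : BL2} (hT : T ∈ Subsemiring.closure gsioQC) :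
    star T ∈ Subsemiring.closure gsioQC := by
  induction hT using Subsemiring.closure_induction with
  | mem x hx => exact Subsemiring.subset_closure (star_mem_gsioQC hx)
  | zero => rw [star_zero]; exact zero_mem _
  | one => rw [star_one]; exact one_mem _
  | add x y _ _ hx hy => rw [star_add]; exact add_mem hx hy
  | mul x y _ _ hx hy => rw [star_mul]; exact mul_mem hy hx

/-- The `C*`-algebra `𝔯_QC`: the operator norm closure of the set of all finite sums of finite
products of operators `R_H`, `H ∈ QC_{2×2}`. -/
def algQC : StarSubalgebra ℂ BL2 where
  toSubsemiring := (Subsemiring.closure gsioQC).topologicalClosure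
  algebraMap_mem' c := by
    refine subset_closure (Subsemiring.subset_closure ?_)
    rw [Algebra.algebraMap_eq_smul_one]
    exact smul_one_mem_gsioQC c
  star_mem' {T} hT := map_mem_closure continuous_star hT fun _ hS => star_mem_closure hS

/-! ### Normalized reproducing kernels -/

/-- For `z = r e^{iα}`, the denominator `1 - z̄ ω` of the reproducing kernel does not vanish on the
circle unless `|z| = 1`, where the numerator vanishes. -/
theorem continuous_kernel (z : ℂ) :
    Continuous fun t : Torus =>
      ((Real.sqrt (1 - ‖z‖ ^ 2) : ℝ) : ℂ) / (1 - conj z * (toCircle t : ℂ)) := by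
  by_cases hz : ‖z‖ < 1
  · refine continuous_const.div (by fun_prop) ?_
    intro t h
    have h' : ‖conj z * (toCircle t : ℂ)‖ = 1 := by
      rw [← sub_eq_zero.mp h, norm_one]
    rw [norm_mul, RCLike.norm_conj, Circle.norm_coe, mul_one] at h'
    exact hz.ne h'
  · have : Real.sqrt (1 - ‖z‖ ^ 2) = 0 := Real.sqrt_eq_zero_of_nonpos (by nlinarith)
    simp only [this, Complex.ofReal_zero, zero_div]
    exact continuous_const

/-- The function `k_z(ω) = √(1 - |z|²) / (1 - z̄ ω)` on the circle (used for `|z| < 1`). -/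
def kernelFun (z : ℂ) : C(Torus, ℂ) := ⟨_, continuous_kernel z⟩

/-- The normalized reproducing kernel `k_z` of `H²`. -/
def kernelPlus (z : ℂ) : L2 := ContinuousMap.toLp 2 arcLength ℂ (kernelFun z)

/-- The function `ω ↦ ω̄ \overline{k_z(ω)}` in `L² ⊖ H²`. -/
def kernelMinus (z : ℂ) : L2 :=
  ContinuousMap.toLp 2 arcLength ℂ (star (fourier 1 * kernelFun z))

/-! ### Essential norm, essential spectrum, essential range -/

/-- The set of compact operators on `L²`. -/
def compactOps : Set BL2 := {K | IsCompactOperator K}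

/-- The essential norm: the distance to the compact operators. -/
def essNorm (T : BL2) : ℝ := Metric.infDist T compactOps

/-- The essential spectrum: the `z` such that `T - z I` is not a Fredholm operator. -/
def essSpectrum (T : BL2) : Set ℂ := {z | ¬ (T - z • (1 : BL2)).IsFredholm}

/-- The essential range of a bounded measurable function. -/
def essRange (f : Linf) : Set ℂ := {z | ∀ ε : ℝ, 0 < ε → 0 < arcLength {t | ‖f t - z‖ < ε}}

/-- `ρ` is the symbol map of `𝔯_QC`, that is, `ρ(T)` consists of the radial limits
`lim_{r → 1⁻} ⟨T k_{rξ}, k_{rξ}⟩` and `lim_{r → 1⁻} ⟨T (z̄ \bar k_{rξ}), z̄ \bar k_{rξ}⟩`, which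
exist for almost every `ξ`. (The inner product of Mathlib is linear in the second variable.) -/
def IsSymbolMap (ρ : algQC → Linf × Linf) : Prop :=
  ∀ T : algQC,
    (∀ᵐ t ∂arcLength, Tendsto
      (fun r : ℝ => inner ℂ (kernelPlus (r * toCircle t)) ((T : BL2) (kernelPlus (r * toCircle t))))
      (𝓝[<] 1) (𝓝 ((ρ T).1 t))) ∧
    (∀ᵐ t ∂arcLength, Tendsto
      (fun r : ℝ =>
        inner ℂ (kernelMinus (r * toCircle t)) ((T : BL2) (kernelMinus (r * toCircle t))))
      (𝓝[<] 1) (𝓝 ((ρ T).2 t)))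

end GSIO

end

noncomputable section

namespace GSIO

/-! ### Basic facts on `L^∞` and multiplication operators -/

/-! Modulo compact operators `R_H` is block diagonal. Its off-diagonal blocks `P₋ g P₊` and `P₊ φ
P₋` are a Hankel operator and the adjoint of one, with quasicontinuous symbols, and these are
compact (`compact_hankel`, the easy half of Hartman's theorem). What remains is `diagOp f ψ = P₊ f
P₊ + P₋ ψ P₋`, and the same compactness makes `diagOp` multiplicative modulo compacts
(`diagOp_mul_sub_mem`). `HasSymbol T f ψ` records that `T` is `diagOp f ψ` plus a compact operator,
with `f` and `ψ` in `QC`.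

The symbol is read off by testing on reproducing kernels. They are unit vectors in `H²` and in its
orthogonal complement, and tend weakly to zero along radii, so compact operators are invisible in
the limit. The remaining quadratic forms are the Poisson integrals of `f` and `ψ`, with radial
limits `f` and `ψ` almost everywhere (`ae_tendsto_poisson`). Hence `max ‖f‖ ‖ψ‖ ≤ ‖T‖`
(`max_norm_le_of_compact`). Applied to `T - K` this bounds the essential norm below; orthogonality
of the two blocks bounds it above. The same estimate makes symbols unique and the set of operators
with a symbol norm closed, so every element of the algebra has one. Conversely, the algebra contains
all matrix units, hence all compact operators.

If `f` and `ψ` are invertible in `QC`, then `diagOp` of the inverses inverts `T` modulo compacts. If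
`T` is Fredholm, a left inverse modulo compacts, tested on the kernels, bounds `|f|` and `|ψ|`
below, and a quasicontinuous function bounded below is invertible in `QC` (`invertibleInQC_of_le`).
This uses that `QC` is a closed star algebra, which rests on Sarason's theorem that `H^∞ + C` is a
closed algebra. -/

theorem linf_norm_le_of_ae {f : Linf} {C : ℝ} (hC : 0 ≤ C) (h : ∀ᵐ t ∂arcLength, ‖f t‖ ≤ C) :
    ‖f‖ ≤ C := by
  simpa using Lp.norm_le_of_ae_bound hC h

theorem linf_ae_norm_le (f : Linf) : ∀ᵐ t ∂arcLength, ‖f t‖ ≤ ‖f‖ := by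
  have h : ∀ᵐ t ∂arcLength, ‖f t‖ₑ ≤ eLpNormEssSup f arcLength := ae_le_eLpNormEssSup
  filter_upwards [h] with t ht
  have hf : eLpNorm f ∞ arcLength ≠ ∞ := Lp.eLpNorm_ne_top f
  rw [Lp.norm_def]
  rw [← eLpNorm_exponent_top] at ht
  simpa using (ENNReal.toReal_mono hf ht)

theorem linf_norm_mul_le (f g : Linf) : ‖f * g‖ ≤ ‖f‖ * ‖g‖ :=
  Lp.norm_smul_le (r := ∞) f g

theorem linf_norm_one_le : ‖(1 : Linf)‖ ≤ 1 :=
  linf_norm_le_of_ae zero_le_one (by filter_upwards [coeFn_one] with t h; simp [h])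

theorem linf_norm_star (f : Linf) : ‖star f‖ = ‖f‖ := by
  have key : ∀ g : Linf, ‖star g‖ ≤ ‖g‖ := fun g => linf_norm_le_of_ae (norm_nonneg _) (by
    filter_upwards [coeFn_star g, linf_ae_norm_le g] with t h₁ h₂
    rw [h₁, RCLike.norm_conj]; exact h₂)
  exact le_antisymm (key f) (by simpa using key (star f))

theorem continuous_linf_star : Continuous (star : Linf → Linf) :=
  (Isometry.of_dist_eq fun f g => by
    rw [dist_eq_norm, dist_eq_norm, ← star_sub, linf_norm_star]).continuous

theorem continuous_linf_mul_left (f : Linf) : Continuous fun g : Linf => f * g :=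
  (AddMonoidHomClass.continuous_of_bound (AddMonoidHom.mulLeft f) ‖f‖ fun g =>
    linf_norm_mul_le f g)

theorem linf_star_smul (c : ℂ) (f : Linf) : star (c • f) = conj c • star f := by
  apply Lp.ext
  filter_upwards [coeFn_star (c • f), Lp.coeFn_smul c f, Lp.coeFn_smul (conj c) (star f),
    coeFn_star f] with t h₁ h₂ h₃ h₄
  rw [h₁, h₂, h₃, Pi.smul_apply, Pi.smul_apply, h₄, smul_eq_mul, smul_eq_mul, map_mul]

/-- Multiplication operators depend linearly and continuously on their symbol. -/
def mulOpL : Linf →L[ℂ] BL2 := (ContinuousLinearMap.mul ℂ ℂ).holderL arcLength ∞ 2 2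

theorem mulOp_add (f g : Linf) : mulOp (f + g) = mulOp f + mulOp g := map_add mulOpL f g

theorem mulOp_sub (f g : Linf) : mulOp (f - g) = mulOp f - mulOp g := map_sub mulOpL f g

theorem mulOp_smul (c : ℂ) (f : Linf) : mulOp (c • f) = c • mulOp f := map_smul mulOpL c f

theorem mulOp_one : mulOp 1 = 1 := by
  simpa using mulOp_smul_one 1

theorem mulOp_mul (f g : Linf) : mulOp (f * g) = mulOp f * mulOp g := by
  ext1 x
  apply Lp.ext
  change ⇑(mulOp (f * g) x) =ᵐ[arcLength] ⇑(mulOp f (mulOp g x))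
  filter_upwards [coeFn_mulOp (f * g) x, coeFn_mulOp f (mulOp g x), coeFn_mulOp g x,
    coeFn_mul f g] with t h₁ h₂ h₃ h₄
  rw [h₁, h₂, h₃, h₄, mul_assoc]

theorem norm_mulOp_le (f : Linf) : ‖mulOp f‖ ≤ ‖f‖ := by
  refine ContinuousLinearMap.opNorm_le_bound _ (norm_nonneg _) fun x => ?_
  have h := (ContinuousLinearMap.mul ℂ ℂ).norm_holder_apply_apply_le (r := 2) f x
  refine h.trans ?_
  gcongr
  have := ContinuousLinearMap.opNorm_mul_le ℂ ℂ
  nlinarith [norm_nonneg f]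

/-! ### Exponentials -/

/-- The exponential `e^{inθ}` in `L²`. -/
abbrev expL2 (n : ℤ) : L2 := fourierLp 2 n

/-- The exponential `e^{inθ}` in `L^∞`. -/
abbrev expInf (n : ℤ) : Linf := fourierLp ∞ n

theorem expInf_zero : expInf 0 = 1 := by
  apply Lp.ext
  filter_upwards [coeFn_fourierLp (T := 2 * Real.pi) ∞ 0, coeFn_one] with t h₁ h₂
  rw [h₁, h₂, fourier_zero]

theorem expInf_mul (m n : ℤ) : expInf m * expInf n = expInf (m + n) := by
  apply Lp.ext
  filter_upwards [coeFn_fourierLp (T := 2 * Real.pi) ∞ m, coeFn_fourierLp (T := 2 * Real.pi) ∞ n,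
    coeFn_fourierLp (T := 2 * Real.pi) ∞ (m + n), coeFn_mul (expInf m) (expInf n)]
    with t h₁ h₂ h₃ h₄
  rw [h₄, h₁, h₂, h₃, fourier_add]

theorem mulOp_expInf (m n : ℤ) : mulOp (expInf m) (expL2 n) = expL2 (m + n) := by
  apply Lp.ext
  filter_upwards [coeFn_fourierLp (T := 2 * Real.pi) ∞ m, coeFn_fourierLp (T := 2 * Real.pi) 2 n,
    coeFn_fourierLp (T := 2 * Real.pi) 2 (m + n), coeFn_mulOp (expInf m) (expL2 n)]
    with t h₁ h₂ h₃ h₄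
  rw [h₄, h₁, h₂, h₃, fourier_add]

theorem expInf_mem_contFun (n : ℤ) : expInf n ∈ contFun :=
  ⟨fourier n, coeFn_fourierLp ∞ n⟩

theorem inner_expL2 (m n : ℤ) : inner ℂ (expL2 m) (expL2 n) = if m = n then (1 : ℂ) else 0 :=
  orthonormal_iff_ite.mp orthonormal_fourier m n

theorem norm_expL2 (n : ℤ) : ‖expL2 n‖ = 1 := orthonormal_fourier.1 n

theorem hasSum_expL2 (x : L2) : HasSum (fun n => inner ℂ (expL2 n) x • expL2 n) x := by
  simpa [HilbertBasis.repr_apply_apply, coe_fourierBasis] using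
    (fourierBasis (T := 2 * Real.pi)).hasSum_repr x

theorem eq_of_inner_expL2 {x y : L2} (h : ∀ n, inner ℂ (expL2 n) x = inner ℂ (expL2 n) y) :
    x = y := by
  have hx := hasSum_expL2 x
  simp only [h] at hx
  exact hx.unique (hasSum_expL2 y)

/-- Operators that agree on all exponentials are equal. -/
theorem op_ext {S T : BL2} (h : ∀ n, S (expL2 n) = T (expL2 n)) : S = T := by
  ext1 x
  have hS := (hasSum_expL2 x).mapL S
  have hT := (hasSum_expL2 x).mapL T
  simp only [map_smul, h] at hS hT
  exact hS.unique hT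

theorem inner_mulOp_expL2 (f : Linf) (m n : ℤ) :
    inner ℂ (expL2 n) (mulOp f (expL2 m)) = fourierCoeff f (n - m) := by
  rw [L2.inner_def, fourierCoeff]
  apply integral_congr_ae
  filter_upwards [coeFn_fourierLp (T := 2 * Real.pi) 2 n, coeFn_fourierLp (T := 2 * Real.pi) 2 m,
    coeFn_mulOp f (expL2 m)] with t h₁ h₂ h₃
  rw [h₁, h₃, h₂, neg_sub, sub_eq_add_neg, fourier_add, fourier_neg, smul_eq_mul,
    RCLike.inner_apply]
  ring

theorem fourierCoeff_eq_inner (f : Linf) (n : ℤ) :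
    fourierCoeff f n = inner ℂ (expL2 n) (mulOp f (expL2 0)) := by
  rw [inner_mulOp_expL2, sub_zero]

/-- The Fourier coefficients of a bounded function, as continuous functionals. -/
def coeffL (n : ℤ) : Linf →L[ℂ] ℂ :=
  (innerSL ℂ (expL2 n)).comp ((ContinuousLinearMap.apply ℂ L2 (expL2 0)).comp mulOpL)

theorem coeffL_apply (n : ℤ) (f : Linf) : coeffL n f = fourierCoeff f n := by
  rw [fourierCoeff_eq_inner]; rfl

theorem norm_fourierCoeff_le (f : Linf) (n : ℤ) : ‖fourierCoeff f n‖ ≤ ‖f‖ := by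
  rw [fourierCoeff_eq_inner]
  refine (norm_inner_le_norm _ _).trans ?_
  rw [norm_expL2, one_mul]
  simpa [norm_expL2] using (ContinuousLinearMap.le_of_opNorm_le _ (norm_mulOp_le f) (expL2 0))

theorem fourierCoeff_mul_expInf (f : Linf) (m n : ℤ) :
    fourierCoeff (f * expInf m : Linf) n = fourierCoeff f (n - m) := by
  rw [fourierCoeff_eq_inner, mulOp_mul, mul_apply_eq_comp, mulOp_expInf, add_zero,
    inner_mulOp_expL2]

theorem fourierCoeff_expInf (m n : ℤ) :
    fourierCoeff (expInf m) n = if n = m then (1 : ℂ) else 0 := by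
  rw [fourierCoeff_eq_inner, mulOp_expInf, add_zero, inner_expL2]

/-- A closed subspace of `L^∞` containing the exponentials contains the continuous functions. -/
theorem contFun_subset_of_expInf_mem {S : Submodule ℂ Linf} (hS : IsClosed (S : Set Linf))
    (h : ∀ n, expInf n ∈ S) : contFun ⊆ S := by
  rintro f ⟨c, hc⟩
  have hf : f = ContinuousMap.toLp ∞ arcLength ℂ c :=
    Lp.ext (hc.trans (ContinuousMap.coeFn_toLp arcLength c).symm)
  have hcl : IsClosed ((S.comap (ContinuousMap.toLp ∞ arcLength ℂ :
      C(Torus, ℂ) →L[ℂ] Linf).toLinearMap : Submodule ℂ C(Torus, ℂ)) : Set C(Torus, ℂ)) :=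
    hS.preimage (ContinuousMap.toLp ∞ arcLength ℂ : C(Torus, ℂ) →L[ℂ] Linf).continuous
  -- Trigonometric polynomials are uniformly dense, and the embedding of `C(𝕋)` into `L^∞` is
  -- continuous.
  have hle : (Submodule.span ℂ (Set.range (@fourier (2 * Real.pi)))).topologicalClosure ≤
      S.comap (ContinuousMap.toLp ∞ arcLength ℂ : C(Torus, ℂ) →L[ℂ] Linf).toLinearMap := by
    refine Submodule.topologicalClosure_minimal _ (Submodule.span_le.mpr ?_) hcl
    rintro _ ⟨n, rfl⟩
    exact h n
  rw [span_fourier_closure_eq_top] at hle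
  rw [hf]
  exact hle (Submodule.mem_top (x := c))

/-! ### The Riesz projection -/

theorem expL2_mem_hardy {n : ℤ} (hn : 0 ≤ n) : expL2 n ∈ hardy :=
  Submodule.le_topologicalClosure _ (Submodule.subset_span ⟨n, hn, rfl⟩)

theorem expL2_mem_hardy_orthogonal {n : ℤ} (hn : n < 0) : expL2 n ∈ hardyᗮ := by
  rw [hardy, Submodule.orthogonal_closure, Submodule.mem_orthogonal]
  intro u hu
  induction hu using Submodule.span_induction with
  | mem x hx =>
    obtain ⟨m, hm, rfl⟩ := hx
    rw [inner_expL2, if_neg (by omega)]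
  | zero => simp
  | add x y _ _ hx hy => rw [inner_add_left, hx, hy, add_zero]
  | smul c x _ hx => rw [inner_smul_left, hx, mul_zero]

theorem Pplus_expL2 (n : ℤ) : Pplus (expL2 n) = if 0 ≤ n then expL2 n else 0 := by
  split_ifs with h
  · exact Submodule.starProjection_eq_self_iff.mpr (expL2_mem_hardy h)
  · exact (Submodule.starProjection_apply_eq_zero_iff _).mpr
      (expL2_mem_hardy_orthogonal (not_le.mp h))

theorem Pminus_expL2 (n : ℤ) : Pminus (expL2 n) = if 0 ≤ n then 0 else expL2 n := by
  rw [Pminus, sub_apply, one_apply_eq_self, Pplus_expL2]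
  split_ifs <;> simp

theorem Pminus_mul_Pminus : Pminus * Pminus = Pminus := by
  simp only [Pminus, sub_mul, mul_sub, one_mul, mul_one, Pplus_mul_Pplus, sub_self, sub_zero]

theorem Pplus_mul_Pminus : Pplus * Pminus = 0 := by
  rw [Pminus, mul_sub, mul_one, Pplus_mul_Pplus, sub_self]

theorem Pminus_mul_Pplus : Pminus * Pplus = 0 := by
  rw [Pminus, sub_mul, one_mul, Pplus_mul_Pplus, sub_self]

theorem Pplus_add_Pminus : Pplus + Pminus = 1 := by
  rw [Pminus, add_sub_cancel]

theorem inner_Pplus (x y : L2) : inner ℂ (Pplus x) y = inner ℂ x (Pplus y) := by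
  conv_lhs => rw [← star_Pplus]
  exact ContinuousLinearMap.adjoint_inner_left Pplus y x

theorem inner_Pminus (x y : L2) : inner ℂ (Pminus x) y = inner ℂ x (Pminus y) := by
  conv_lhs => rw [← star_Pminus]
  exact ContinuousLinearMap.adjoint_inner_left Pminus y x

theorem norm_sq_Pplus_add_Pminus (x y : L2) :
    ‖Pplus x + Pminus y‖ ^ 2 = ‖Pplus x‖ ^ 2 + ‖Pminus y‖ ^ 2 := by
  have h : inner ℂ (Pplus x) (Pminus y) = 0 := by
    rw [inner_Pplus, ← mul_apply_eq_comp, Pplus_mul_Pminus]; simp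
  have := norm_add_sq_eq_norm_sq_add_norm_sq_of_inner_eq_zero _ _ h
  simpa [sq] using this

theorem norm_Pplus_le (x : L2) : ‖Pplus x‖ ≤ ‖x‖ := Submodule.norm_starProjection_apply_le _ _

theorem norm_Pminus_le (x : L2) : ‖Pminus x‖ ≤ ‖x‖ := by
  have h := norm_sq_Pplus_add_Pminus x x
  rw [← add_apply, Pplus_add_Pminus, one_apply_eq_self] at h
  exact le_of_sq_le_sq (by nlinarith [sq_nonneg ‖Pplus x‖]) (norm_nonneg _)

/-- The operator `P₊ f P₊ + P₋ ψ P₋`. -/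
def diagOp (f ψ : Linf) : BL2 := Pplus * mulOp f * Pplus + Pminus * mulOp ψ * Pminus

theorem diagOp_add (f g φ ψ : Linf) : diagOp (f + g) (φ + ψ) = diagOp f φ + diagOp g ψ := by
  simp only [diagOp, mulOp_add, mul_add, add_mul]; abel

theorem diagOp_sub (f g φ ψ : Linf) : diagOp (f - g) (φ - ψ) = diagOp f φ - diagOp g ψ := by
  simp only [diagOp, mulOp_sub, mul_sub, sub_mul]; abel

theorem diagOp_smul_one (c : ℂ) : diagOp (c • 1) (c • 1) = c • 1 := by
  simp only [diagOp, mulOp_smul_one, mul_smul_comm, smul_mul_assoc, mul_one, Pplus_mul_Pplus,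
    Pminus_mul_Pminus]
  rw [← smul_add, Pplus_add_Pminus]

theorem star_diagOp (f ψ : Linf) : star (diagOp f ψ) = diagOp (star f) (star ψ) := by
  simp only [diagOp, star_add, star_mul, star_mulOp, star_Pplus, star_Pminus, mul_assoc]

/-- The two blocks act on orthogonal components of `x` and have orthogonal ranges, so Pythagoras on
both sides gives the maximum rather than the sum. -/
theorem norm_diagOp_le (f ψ : Linf) : ‖diagOp f ψ‖ ≤ max ‖f‖ ‖ψ‖ := by
  have hM : 0 ≤ max ‖f‖ ‖ψ‖ := le_max_of_le_left (norm_nonneg _)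
  refine ContinuousLinearMap.opNorm_le_bound _ hM fun x => ?_
  refine le_of_sq_le_sq ?_ (by positivity)
  have h1 : ‖Pplus (mulOp f (Pplus x))‖ ≤ max ‖f‖ ‖ψ‖ * ‖Pplus x‖ :=
    (norm_Pplus_le _).trans <| (ContinuousLinearMap.le_of_opNorm_le _ (norm_mulOp_le f) _).trans
      (by gcongr; exact le_max_left _ _)
  have h2 : ‖Pminus (mulOp ψ (Pminus x))‖ ≤ max ‖f‖ ‖ψ‖ * ‖Pminus x‖ :=
    (norm_Pminus_le _).trans <| (ContinuousLinearMap.le_of_opNorm_le _ (norm_mulOp_le ψ) _).trans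
      (by gcongr; exact le_max_right _ _)
  have h3 := norm_sq_Pplus_add_Pminus (mulOp f (Pplus x)) (mulOp ψ (Pminus x))
  have h4 := norm_sq_Pplus_add_Pminus x x
  rw [← add_apply, Pplus_add_Pminus, one_apply_eq_self] at h4
  have h5 : diagOp f ψ x = Pplus (mulOp f (Pplus x)) + Pminus (mulOp ψ (Pminus x)) := rfl
  rw [h5, h3, mul_pow, h4, mul_add, ← mul_pow, ← mul_pow]
  gcongr

/-! ### Compact operators -/

/-- The compact operators as a subspace. -/
abbrev compactSub : Submodule ℂ BL2 := compactOperator (RingHom.id ℂ) L2 L2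

theorem isClosed_compactSub : IsClosed (compactSub : Set BL2) :=
  isClosed_setOfPred_isCompactOperator

theorem mul_mem_compactSub_left (A : BL2) {K : BL2} (hK : K ∈ compactSub) : A * K ∈ compactSub :=
  IsCompactOperator.clm_comp hK A

theorem mul_mem_compactSub_right {K : BL2} (hK : K ∈ compactSub) (A : BL2) : K * A ∈ compactSub :=
  IsCompactOperator.comp_clm hK A

/-- The matrix unit sending `e^{imθ}` to `e^{inθ}`. -/
def matUnit (n m : ℤ) : BL2 := InnerProductSpace.rankOne ℂ (expL2 n) (expL2 m)

theorem matUnit_apply (n m : ℤ) (x : L2) : matUnit n m x = inner ℂ (expL2 m) x • expL2 n := rfl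

theorem star_matUnit (n m : ℤ) : star (matUnit n m) = matUnit m n :=
  InnerProductSpace.adjoint_rankOne _ _

theorem rankOne_mem_compactSub (x y : L2) : InnerProductSpace.rankOne ℂ x y ∈ compactSub := by
  rw [InnerProductSpace.rankOne_def']
  exact (isCompactOperator_of_locallyCompactSpace_rng (ContinuousLinearMap.toSpanSingleton ℂ x)).comp_clm _

theorem matUnit_mem_compactSub (n m : ℤ) : matUnit n m ∈ compactSub := rankOne_mem_compactSub _ _

/-- A rank one operator depends continuously and conjugate-linearly on its second vector, so the
Fourier series of `x` exhibits it as a norm limit of combinations of matrix units. -/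
theorem rankOne_expL2_mem {S : Submodule ℂ BL2} (hS : IsClosed (S : Set BL2))
    (h : ∀ n m, matUnit n m ∈ S) (n : ℤ) (x : L2) :
    InnerProductSpace.rankOne ℂ (expL2 n) x ∈ S := by
  have hx := (hasSum_expL2 x).mapL (InnerProductSpace.rankOne ℂ (expL2 n))
  refine hS.mem_of_tendsto hx (Eventually.of_forall fun s => S.sum_mem fun m _ => ?_)
  rw [ContinuousLinearMap.map_smulₛₗ]
  exact S.smul_mem _ (h n m)

/-- The orthogonal projection onto the span of the exponentials with index in `s`. -/
def cutoff (s : Finset ℤ) : BL2 := ∑ n ∈ s, matUnit n n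

theorem cutoff_apply (s : Finset ℤ) (x : L2) :
    cutoff s x = ∑ n ∈ s, inner ℂ (expL2 n) x • expL2 n := by
  simp [cutoff, matUnit_apply]

theorem norm_cutoff_apply_le (s : Finset ℤ) (x : L2) : ‖cutoff s x‖ ≤ ‖x‖ := by
  have h1 := (orthonormal_fourier (T := 2 * Real.pi)).sum_inner_products_le x (s := s)
  have h2 := (orthonormal_fourier (T := 2 * Real.pi)).inner_sum
    (fun n => inner ℂ (expL2 n) x) (fun n => inner ℂ (expL2 n) x) s
  have h3 : (‖cutoff s x‖ ^ 2 : ℝ) = ∑ n ∈ s, ‖inner ℂ (expL2 n) x‖ ^ 2 := by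
    have h4 := inner_self_eq_norm_sq_to_K (𝕜 := ℂ) (cutoff s x)
    rw [cutoff_apply] at h4 ⊢
    rw [h2] at h4
    simp only [RCLike.conj_mul] at h4
    exact_mod_cast h4.symm
  exact le_of_sq_le_sq (h3.trans_le h1) (norm_nonneg _)

theorem tendsto_cutoff (x : L2) : Tendsto (fun s => cutoff s x) atTop (𝓝 x) := by
  simp only [cutoff_apply]
  exact hasSum_expL2 x

/-- The cutoffs are contractions converging strongly to the identity, hence uniformly on the
relatively compact image of the unit ball. In particular compact operators are norm limits of finite
rank ones. -/
theorem tendsto_cutoff_mul {K : BL2} (hK : K ∈ compactSub) :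
    Tendsto (fun s => cutoff s * K) atTop (𝓝 K) := by
  rw [Metric.tendsto_nhds]
  intro ε hε
  have hcomp : IsCompact (closure (K '' Metric.closedBall 0 1)) :=
    IsCompactOperator.isCompact_closure_image_closedBall (f := (K : L2 →ₗ[ℂ] L2)) hK 1
  obtain ⟨t, ht, hcov⟩ := Metric.totallyBounded_iff.mp hcomp.totallyBounded (ε / 4) (by positivity)
  have hev : ∀ᶠ s in (atTop : Filter (Finset ℤ)), ∀ y ∈ t, dist (cutoff s y) y < ε / 4 :=
    (ht.eventually_all).mpr fun y _ => Metric.tendsto_nhds.mp (tendsto_cutoff y) _ (by positivity)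
  filter_upwards [hev] with s hs
  rw [dist_eq_norm]
  -- The distance to the net is paid twice and the convergence on the net once; `ε / 4` leaves room
  -- for the strict inequality.
  have hle : ‖cutoff s * K - K‖ ≤ 3 * (ε / 4) := by
    refine ContinuousLinearMap.opNorm_le_of_unit_norm (by positivity) fun x hx => ?_
    have hKx : K x ∈ closure (K '' Metric.closedBall 0 1) :=
      subset_closure ⟨x, by simp [hx], rfl⟩
    obtain ⟨y, hy, hxy⟩ := Set.mem_iUnion₂.mp (hcov hKx)
    rw [Metric.mem_ball, dist_eq_norm] at hxy
    have h1 : ‖cutoff s y - y‖ < ε / 4 := by simpa [dist_eq_norm] using hs y hy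
    have h2 : (cutoff s * K - K) x = cutoff s (K x - y) + (cutoff s y - y) - (K x - y) := by
      rw [sub_apply, mul_apply_eq_comp, map_sub]; abel
    rw [h2]
    have h3 := norm_cutoff_apply_le s (K x - y)
    have h4 := norm_sub_le (cutoff s (K x - y) + (cutoff s y - y)) (K x - y)
    have h5 := norm_add_le (cutoff s (K x - y)) (cutoff s y - y)
    linarith
  linarith

theorem cutoff_mul (s : Finset ℤ) (K : BL2) :
    cutoff s * K = ∑ n ∈ s, InnerProductSpace.rankOne ℂ (expL2 n) (star K (expL2 n)) := by
  rw [cutoff, Finset.sum_mul]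
  exact Finset.sum_congr rfl fun n _ => InnerProductSpace.rankOne_comp _ _ _

/-- A closed space of operators containing the matrix units contains the compact operators. -/
theorem compactSub_le_of_matUnit_mem {S : Submodule ℂ BL2} (hS : IsClosed (S : Set BL2))
    (h : ∀ n m, matUnit n m ∈ S) : compactSub ≤ S := by
  intro K hK
  refine hS.mem_of_tendsto (tendsto_cutoff_mul hK) (Eventually.of_forall fun s => ?_)
  rw [SetLike.mem_coe, cutoff_mul]
  exact S.sum_mem fun n _ => rankOne_expL2_mem hS h n _

/-- Schauder's theorem by density: the operators with compact adjoint form a closed subspace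
containing the matrix units. -/
theorem star_mem_compactSub {K : BL2} (hK : K ∈ compactSub) : star K ∈ compactSub := by
  let S : Submodule ℂ BL2 :=
    { carrier := {T | star T ∈ compactSub}
      add_mem' := fun {a b} ha hb => by
        change star (a + b) ∈ compactSub; rw [star_add]; exact add_mem ha hb
      zero_mem' := by change star (0 : BL2) ∈ compactSub; rw [star_zero]; exact zero_mem _
      smul_mem' := fun c a ha => by
        change star (c • a) ∈ compactSub; rw [star_smul]; exact Submodule.smul_mem _ _ ha }
  have hS : IsClosed (S : Set BL2) := isClosed_compactSub.preimage continuous_star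
  exact compactSub_le_of_matUnit_mem hS (fun n m => by
    change star (matUnit n m) ∈ compactSub; rw [star_matUnit]; exact matUnit_mem_compactSub m n) hK

/-! ### Fredholm operators -/

open scoped LinearMap.FiniteRangeSetoid

theorem hasFiniteRange_rankOne (x y : L2) :
    (InnerProductSpace.rankOne ℂ x y : L2 →ₗ[ℂ] L2).HasNoetherianRange := by
  rw [LinearMap.hasNoetherianRange_iff_range]
  have : (InnerProductSpace.rankOne ℂ x y : L2 →ₗ[ℂ] L2).range ≤ Submodule.span ℂ {x} := by
    rintro _ ⟨z, rfl⟩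
    exact Submodule.smul_mem _ _ (Submodule.mem_span_singleton_self x)
  have := Submodule.finiteDimensional_of_le this
  infer_instance

theorem hasFiniteRange_cutoff_mul (s : Finset ℤ) (K : BL2) :
    ((cutoff s * K : BL2) : L2 →ₗ[ℂ] L2).HasNoetherianRange := by
  rw [cutoff_mul, ContinuousLinearMap.toLinearMap_sum]
  exact (LinearMap.finiteRange ℂ L2 L2).sum_mem fun n _ => hasFiniteRange_rankOne _ _

theorem mem_compactSub_of_hasFiniteRange {F : BL2}
    (hF : (F : L2 →ₗ[ℂ] L2).HasNoetherianRange) : F ∈ compactSub := by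
  rw [LinearMap.hasNoetherianRange_iff_range] at hF
  have : FiniteDimensional ℂ (F : L2 →ₗ[ℂ] L2).range := inferInstance
  have : ProperSpace (F : L2 →ₗ[ℂ] L2).range := FiniteDimensional.proper ℂ _
  have h : IsCompactOperator (F.codRestrict (F : L2 →ₗ[ℂ] L2).range fun x => ⟨x, rfl⟩) :=
    isCompactOperator_of_locallyCompactSpace_dom _
  exact h.clm_comp (F : L2 →ₗ[ℂ] L2).range.subtypeL

/-- Write `K` as an operator of norm less than `1` plus one of finite rank. The identity plus the
small part is invertible by a Neumann series, and its inverse inverts `1 + K` modulo finite rank. -/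
theorem one_add_compact_quasiInverse {K : BL2} (hK : K ∈ compactSub) :
    ∃ V : BL2, LinearMap.IsQuasiInverse (V : L2 →ₗ[ℂ] L2) ((1 + K : BL2) : L2 →ₗ[ℂ] L2) := by
  obtain ⟨s, hs⟩ := (Metric.tendsto_nhds.mp (tendsto_cutoff_mul hK) 1 one_pos).exists
  rw [dist_comm, dist_eq_norm] at hs
  let u : BL2ˣ := Units.oneSub (-(K - cutoff s * K)) (by rwa [norm_neg])
  have hu : 1 + K = (u : BL2) + cutoff s * K := by
    change _ = 1 - -(K - cutoff s * K) + _
    abel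
  refine ⟨(↑u⁻¹ : BL2), ?_, ?_⟩
  · refine LinearMap.FiniteRangeSetoid.equiv_iff_hasNoetherianRange.mpr ?_
    have h : ((↑u⁻¹ : BL2) : L2 →ₗ[ℂ] L2) ∘ₗ ((1 + K : BL2) : L2 →ₗ[ℂ] L2) - LinearMap.id
        = ((↑u⁻¹ : BL2) : L2 →ₗ[ℂ] L2) ∘ₗ ((cutoff s * K : BL2) : L2 →ₗ[ℂ] L2) := by
      have h1 : (↑u⁻¹ : BL2) * (1 + K) - 1 = ↑u⁻¹ * (cutoff s * K) := by
        rw [hu, mul_add, u.inv_mul, add_sub_cancel_left]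
      exact congrArg (fun T : BL2 => (T : L2 →ₗ[ℂ] L2)) h1
    rw [h]
    exact (hasFiniteRange_cutoff_mul s K).comp_left _
  · refine LinearMap.FiniteRangeSetoid.equiv_iff_hasNoetherianRange.mpr ?_
    have h : ((1 + K : BL2) : L2 →ₗ[ℂ] L2) ∘ₗ ((↑u⁻¹ : BL2) : L2 →ₗ[ℂ] L2) - LinearMap.id
        = ((cutoff s * K : BL2) : L2 →ₗ[ℂ] L2) ∘ₗ ((↑u⁻¹ : BL2) : L2 →ₗ[ℂ] L2) := by
      have h1 : (1 + K) * (↑u⁻¹ : BL2) - 1 = (cutoff s * K) * ↑u⁻¹ := by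
        rw [hu, add_mul, u.mul_inv, add_sub_cancel_left]
      exact congrArg (fun T : BL2 => (T : L2 →ₗ[ℂ] L2)) h1
    rw [h]
    exact (hasFiniteRange_cutoff_mul s K).comp_right _

/-- An operator that is invertible modulo the compact operators is Fredholm. -/
theorem isFredholm_of_inverse_mod_compact {A B : BL2} (h₁ : A * B - 1 ∈ compactSub)
    (h₂ : B * A - 1 ∈ compactSub) : A.IsFredholm := by
  obtain ⟨V, hV⟩ := one_add_compact_quasiInverse h₁
  obtain ⟨W, hW⟩ := one_add_compact_quasiInverse h₂
  rw [add_sub_cancel] at hV hW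
  have hr : (A : L2 →ₗ[ℂ] L2) ∘ₗ (B : L2 →ₗ[ℂ] L2) ∘ₗ (V : L2 →ₗ[ℂ] L2) ≈ LinearMap.id := hV.2
  have hl : (W : L2 →ₗ[ℂ] L2) ∘ₗ (B : L2 →ₗ[ℂ] L2) ∘ₗ (A : L2 →ₗ[ℂ] L2) ≈ LinearMap.id := hW.1
  -- Modulo finite rank, `W * B` is a left inverse and `B * V` a right inverse of `A`. As in any
  -- ring the two then agree, so `W * B` is also a right inverse.
  refine ContinuousLinearMap.IsFredholm.of_isQuasiInverse (v := W * B) ⟨hl, ?_⟩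
  let a := (A : L2 →ₗ[ℂ] L2)
  let b := (B : L2 →ₗ[ℂ] L2)
  let v := (V : L2 →ₗ[ℂ] L2)
  let w := (W : L2 →ₗ[ℂ] L2)
  change a ∘ₗ b ∘ₗ v ≈ LinearMap.id at hr
  change w ∘ₗ b ∘ₗ a ≈ LinearMap.id at hl
  change a ∘ₗ (w ∘ₗ b) ≈ LinearMap.id
  calc a ∘ₗ (w ∘ₗ b) = (a ∘ₗ (w ∘ₗ b)) ∘ₗ LinearMap.id := rfl
    _ ≈ (a ∘ₗ (w ∘ₗ b)) ∘ₗ (a ∘ₗ b ∘ₗ v) := by grw [hr]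
    _ = a ∘ₗ (w ∘ₗ b ∘ₗ a) ∘ₗ (b ∘ₗ v) := rfl
    _ ≈ a ∘ₗ LinearMap.id ∘ₗ (b ∘ₗ v) := by grw [hl]
    _ ≈ LinearMap.id := hr

/-- A Fredholm operator has a left inverse modulo the compact operators. -/
theorem exists_left_inverse_mod_compact {A : BL2} (hA : A.IsFredholm) :
    ∃ B : BL2, B * A - 1 ∈ compactSub := by
  obtain ⟨B, hB, -⟩ := hA.exists_isQuasiInverse
  exact ⟨B, mem_compactSub_of_hasFiniteRange
    (LinearMap.FiniteRangeSetoid.equiv_iff_hasNoetherianRange.mp hB)⟩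

/-! ### Weakly null families and compact operators -/

/-- A compact operator maps a bounded family whose Fourier coefficients tend to `0` to a null
family. -/
theorem tendsto_compact_of_inner {ι : Type*} {l : Filter ι} {u : ι → L2}
    (hu : ∀ᶠ i in l, ‖u i‖ ≤ 1) (h : ∀ m, Tendsto (fun i => inner ℂ (expL2 m) (u i)) l (𝓝 0))
    {K : BL2} (hK : K ∈ compactSub) : Tendsto (fun i => K (u i)) l (𝓝 0) := by
  -- Boundedness of the family makes the operators with the desired property a closed subspace, so
  -- it suffices to test matrix units.
  let S : Submodule ℂ BL2 :=
    { carrier := {T | Tendsto (fun i => T (u i)) l (𝓝 0)}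
      add_mem' := fun {a b} ha hb => by simpa using Tendsto.add ha hb
      zero_mem' := tendsto_const_nhds
      smul_mem' := fun c a ha => by simpa using Tendsto.const_smul ha c }
  have hS : IsClosed (S : Set BL2) := by
    refine isClosed_of_closure_subset fun T hT => ?_
    change Tendsto (fun i => T (u i)) l (𝓝 0)
    rw [Metric.tendsto_nhds]
    intro ε hε
    obtain ⟨T', hT', hd⟩ := Metric.mem_closure_iff.mp hT (ε / 2) (by positivity)
    filter_upwards [hu, Metric.tendsto_nhds.mp hT' (ε / 2) (by positivity)] with i hi hi'
    rw [dist_eq_norm, sub_zero] at hi' ⊢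
    rw [dist_eq_norm] at hd
    have h1 : T (u i) = (T - T') (u i) + T' (u i) := by rw [sub_apply, sub_add_cancel]
    have h2 : ‖(T - T') (u i)‖ ≤ ‖T - T'‖ * ‖u i‖ := ContinuousLinearMap.le_opNorm _ _
    have h3 : ‖T - T'‖ * ‖u i‖ ≤ ‖T - T'‖ := mul_le_of_le_one_right (norm_nonneg _) hi
    rw [h1]
    linarith [norm_add_le ((T - T') (u i)) (T' (u i))]
  refine compactSub_le_of_matUnit_mem hS (fun n m => ?_) hK
  change Tendsto (fun i => matUnit n m (u i)) l (𝓝 0)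
  simpa [matUnit_apply] using (h m).smul_const (expL2 n)

/-! ### Reproducing kernels -/

/-- The geometric series is taken in the uniform norm so that it can be pushed through the
continuous maps to `L²` and to Fourier coefficients. -/
theorem hasSum_kernelFun {z : ℂ} (hz : ‖z‖ < 1) :
    HasSum (fun n : ℕ => (((Real.sqrt (1 - ‖z‖ ^ 2) : ℝ) : ℂ) * conj z ^ n) •
      (fourier (n : ℤ) : C(Torus, ℂ))) (kernelFun z) := by
  have hs : Summable (fun n : ℕ => (((Real.sqrt (1 - ‖z‖ ^ 2) : ℝ) : ℂ) * conj z ^ n) •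
      (fourier (n : ℤ) : C(Torus, ℂ))) := by
    refine Summable.of_norm_bounded
      ((summable_geometric_of_lt_one (norm_nonneg z) hz).mul_left (Real.sqrt (1 - ‖z‖ ^ 2)))
      fun n => ?_
    rw [norm_smul, fourier_norm, mul_one, norm_mul, norm_pow, RCLike.norm_conj, Complex.norm_real,
      Real.norm_of_nonneg (Real.sqrt_nonneg _)]
  convert hs.hasSum using 1
  ext t
  have h1 := hs.hasSum.mapL (ContinuousMap.evalCLM ℂ t)
  have hw : ‖conj z * (toCircle t : ℂ)‖ < 1 := by
    rwa [norm_mul, RCLike.norm_conj, Circle.norm_coe, mul_one]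
  have h2 := (hasSum_geometric_of_norm_lt_one hw).mul_left ((Real.sqrt (1 - ‖z‖ ^ 2) : ℝ) : ℂ)
  refine h2.unique (h1.congr_fun fun n => ?_)
  simp [mul_pow, mul_assoc, toCircle_nsmul]

theorem hasSum_inner_kernelPlus {z : ℂ} (hz : ‖z‖ < 1) (m : ℤ) :
    HasSum (fun n : ℕ => if m = n then ((Real.sqrt (1 - ‖z‖ ^ 2) : ℝ) : ℂ) * conj z ^ n else 0)
      (inner ℂ (expL2 m) (kernelPlus z)) := by
  have h := ((hasSum_kernelFun hz).mapL (ContinuousMap.toLp 2 arcLength ℂ)).mapL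
    (innerSL ℂ (expL2 m))
  refine h.congr_fun fun n => ?_
  rw [map_smul, map_smul, innerSL_apply_apply]
  change _ = _ • inner ℂ (expL2 m) (expL2 n)
  rw [inner_expL2]
  split_ifs <;> simp

theorem inner_kernelPlus_of_neg {z : ℂ} (hz : ‖z‖ < 1) {m : ℤ} (hm : m < 0) :
    inner ℂ (expL2 m) (kernelPlus z) = 0 := by
  refine (hasSum_inner_kernelPlus hz m).unique ?_
  convert hasSum_zero using 2 with n
  rw [if_neg (by omega)]

/-- The coefficient of index `m ≥ 0` is `√(1 - |z|²) z̄^m`. A bound vanishing as `|z| → 1` is what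
makes the kernels weakly null. -/
theorem norm_inner_kernelPlus_le {z : ℂ} (hz : ‖z‖ < 1) (m : ℤ) :
    ‖inner ℂ (expL2 m) (kernelPlus z)‖ ≤ Real.sqrt (1 - ‖z‖ ^ 2) := by
  rcases lt_or_ge m 0 with hm | hm
  · rw [inner_kernelPlus_of_neg hz hm, norm_zero]; exact Real.sqrt_nonneg _
  · lift m to ℕ using hm
    have h := hasSum_single (f := fun n : ℕ => if (m : ℤ) = n then
      ((Real.sqrt (1 - ‖z‖ ^ 2) : ℝ) : ℂ) * conj z ^ n else 0) m
      fun n hn => if_neg (by omega)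
    rw [(hasSum_inner_kernelPlus hz m).unique h, if_pos rfl, norm_mul, norm_pow, RCLike.norm_conj,
      Complex.norm_real, Real.norm_of_nonneg (Real.sqrt_nonneg _)]
    exact mul_le_of_le_one_right (Real.sqrt_nonneg _) (pow_le_one₀ (norm_nonneg _) hz.le)

/-- Conjugation followed by multiplication by `ω̄` reflects frequencies by `m ↦ -1 - m`, which
exchanges `m ≥ 0` and `m < 0`. Facts about `kernelPlus` transfer through this identity. -/
theorem inner_kernelMinus (z : ℂ) (m : ℤ) :
    inner ℂ (expL2 m) (kernelMinus z) = conj (inner ℂ (expL2 (-1 - m)) (kernelPlus z)) := by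
  rw [kernelMinus, kernelPlus, ContinuousMap.inner_toLp, ContinuousMap.inner_toLp, ← integral_conj]
  congr 1
  ext t
  have h : fourier (-1 - m) t = conj (fourier 1 t) * conj (fourier m t) := by
    rw [sub_eq_add_neg, fourier_add, fourier_neg, fourier_neg]
  rw [h]
  simp only [ContinuousMap.star_apply, ContinuousMap.mul_apply, RCLike.star_def, map_mul,
    Complex.conj_conj]
  ring

theorem Pplus_kernelPlus {z : ℂ} (hz : ‖z‖ < 1) : Pplus (kernelPlus z) = kernelPlus z := by
  refine eq_of_inner_expL2 fun m => ?_
  rw [← inner_Pplus, Pplus_expL2]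
  split_ifs with hm
  · rfl
  · rw [inner_zero_left, inner_kernelPlus_of_neg hz (not_le.mp hm)]

theorem Pplus_kernelMinus {z : ℂ} (hz : ‖z‖ < 1) : Pplus (kernelMinus z) = 0 := by
  refine eq_of_inner_expL2 fun m => ?_
  rw [← inner_Pplus, Pplus_expL2, inner_zero_right]
  split_ifs with hm
  · rw [inner_kernelMinus, inner_kernelPlus_of_neg hz (by omega), map_zero]
  · rw [inner_zero_left]

theorem Pminus_kernelPlus {z : ℂ} (hz : ‖z‖ < 1) : Pminus (kernelPlus z) = 0 := by
  rw [Pminus, sub_apply, one_apply_eq_self, Pplus_kernelPlus hz, sub_self]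

theorem Pminus_kernelMinus {z : ℂ} (hz : ‖z‖ < 1) : Pminus (kernelMinus z) = kernelMinus z := by
  rw [Pminus, sub_apply, one_apply_eq_self, Pplus_kernelMinus hz, sub_zero]

theorem inner_diagOp_kernelPlus {z : ℂ} (hz : ‖z‖ < 1) (f ψ : Linf) :
    inner ℂ (kernelPlus z) (diagOp f ψ (kernelPlus z)) =
      inner ℂ (kernelPlus z) (mulOp f (kernelPlus z)) := by
  change inner ℂ _ (Pplus (mulOp f (Pplus (kernelPlus z)))
    + Pminus (mulOp ψ (Pminus (kernelPlus z)))) = _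
  rw [Pminus_kernelPlus hz, map_zero, map_zero, add_zero, ← inner_Pplus, Pplus_kernelPlus hz]

theorem inner_diagOp_kernelMinus {z : ℂ} (hz : ‖z‖ < 1) (f ψ : Linf) :
    inner ℂ (kernelMinus z) (diagOp f ψ (kernelMinus z)) =
      inner ℂ (kernelMinus z) (mulOp ψ (kernelMinus z)) := by
  change inner ℂ _ (Pplus (mulOp f (Pplus (kernelMinus z)))
    + Pminus (mulOp ψ (Pminus (kernelMinus z)))) = _
  rw [Pplus_kernelMinus hz, map_zero, map_zero, zero_add, ← inner_Pminus, Pminus_kernelMinus hz]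

theorem norm_diagOp_kernelPlus_le {z : ℂ} (hz : ‖z‖ < 1) (f ψ : Linf) :
    ‖diagOp f ψ (kernelPlus z)‖ ≤ ‖mulOp f (kernelPlus z)‖ := by
  change ‖Pplus (mulOp f (Pplus (kernelPlus z))) + Pminus (mulOp ψ (Pminus (kernelPlus z)))‖ ≤ _
  rw [Pminus_kernelPlus hz, map_zero, map_zero, add_zero, Pplus_kernelPlus hz]
  exact norm_Pplus_le _

theorem norm_diagOp_kernelMinus_le {z : ℂ} (hz : ‖z‖ < 1) (f ψ : Linf) :
    ‖diagOp f ψ (kernelMinus z)‖ ≤ ‖mulOp ψ (kernelMinus z)‖ := by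
  change ‖Pplus (mulOp f (Pplus (kernelMinus z))) + Pminus (mulOp ψ (Pminus (kernelMinus z)))‖ ≤ _
  rw [Pplus_kernelMinus hz, map_zero, map_zero, zero_add, Pminus_kernelMinus hz]
  exact norm_Pminus_le _

theorem inner_mulOp_kernelPlus (f : Linf) (z : ℂ) :
    inner ℂ (kernelPlus z) (mulOp f (kernelPlus z)) =
      ∫ t, f t * ((‖kernelFun z t‖ ^ 2 : ℝ) : ℂ) ∂arcLength := by
  rw [L2.inner_def]
  apply integral_congr_ae
  filter_upwards [coeFn_mulOp f (kernelPlus z), ContinuousMap.coeFn_toLp (p := 2) (𝕜 := ℂ)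
    arcLength (kernelFun z)] with t h₁ h₂
  rw [h₁, kernelPlus, h₂, RCLike.inner_apply, mul_assoc, RCLike.mul_conj]
  norm_cast

/-- The two kernels have the same modulus on the circle, so both quadratic forms are the same
Poisson integral. -/
theorem inner_mulOp_kernelMinus (f : Linf) (z : ℂ) :
    inner ℂ (kernelMinus z) (mulOp f (kernelMinus z)) =
      inner ℂ (kernelPlus z) (mulOp f (kernelPlus z)) := by
  rw [inner_mulOp_kernelPlus, L2.inner_def]
  apply integral_congr_ae
  filter_upwards [coeFn_mulOp f (kernelMinus z), ContinuousMap.coeFn_toLp (p := 2) (𝕜 := ℂ)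
    arcLength (star (fourier 1 * kernelFun z))] with t h₁ h₂
  rw [h₁, kernelMinus, h₂, RCLike.inner_apply, mul_assoc, RCLike.mul_conj, ContinuousMap.star_apply,
    norm_star, ContinuousMap.mul_apply, norm_mul, fourier_apply, Circle.norm_coe, one_mul]
  norm_cast

theorem norm_mul_toCircle {r : ℝ} (hr : 0 ≤ r) (t : Torus) : ‖(r : ℂ) * toCircle t‖ = r := by
  rw [norm_mul, Circle.norm_coe, mul_one, Complex.norm_real, Real.norm_of_nonneg hr]

/-! ### Poisson means -/

theorem summable_pow_natAbs {r : ℝ} (h0 : 0 ≤ r) (h1 : r < 1) :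
    Summable fun n : ℤ => r ^ n.natAbs := by
  refine Summable.of_nat_of_neg ?_ ?_ <;> simpa using summable_geometric_of_lt_one h0 h1

/-- The Fourier series of the Poisson kernel. For `w = r e^{i(t-s)}` the frequencies `n ≥ 0` sum to
`1 / (1 - w)` and the others to `w̄ / (1 - w̄)`; together they give `(1 - |w|²) / |1 - w|²`. -/
theorem hasSum_norm_sq_kernelFun {r : ℝ} (h0 : 0 ≤ r) (h1 : r < 1) (t s : Torus) :
    HasSum (fun n : ℤ => ((r : ℂ) ^ n.natAbs * fourier n t) * fourier (-n) s)
      ((‖kernelFun (r * toCircle t) s‖ ^ 2 : ℝ) : ℂ) := by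
  set w : ℂ := r * toCircle t * conj (toCircle s : ℂ) with hw
  have hnw : ‖w‖ = r := by
    rw [hw, norm_mul, norm_mul_toCircle h0, RCLike.norm_conj, Circle.norm_coe, mul_one]
  have hw1 : ‖w‖ < 1 := hnw ▸ h1
  have hA := hasSum_geometric_of_norm_lt_one hw1
  have hB := (hasSum_geometric_of_norm_lt_one (ξ := conj w) (by rwa [RCLike.norm_conj])).mul_left
    (conj w)
  have key := HasSum.of_nat_of_neg_add_one
    (f := fun n : ℤ => ((r : ℂ) ^ n.natAbs * fourier n t) * fourier (-n) s)
    (hA.congr_fun fun n => ?_) (hB.congr_fun fun n => ?_)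
  · convert key using 1
    have hk : kernelFun (r * toCircle t) s =
        ((Real.sqrt (1 - r ^ 2) : ℝ) : ℂ) / (1 - conj w) := by
      change ((Real.sqrt (1 - ‖(r : ℂ) * toCircle t‖ ^ 2) : ℝ) : ℂ) /
        (1 - conj ((r : ℂ) * toCircle t) * (toCircle s : ℂ)) = _
      have hcw : conj w = conj ((r : ℂ) * toCircle t) * (toCircle s : ℂ) := by
        simp only [hw, map_mul, Complex.conj_conj]
      rw [norm_mul_toCircle h0, hcw]
    have hne : 1 - w ≠ 0 := fun h => by
      rw [← sub_eq_zero.mp h, norm_one] at hw1; exact lt_irrefl _ hw1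
    have hne' : 1 - conj w ≠ 0 := fun h => hne (by
      have := congrArg conj h
      simpa using this)
    have hr2 : ((Real.sqrt (1 - r ^ 2) : ℝ) : ℂ) ^ 2 = 1 - w * conj w := by
      rw [RCLike.mul_conj, hnw]
      norm_cast
      rw [Real.sq_sqrt (by nlinarith)]
      push_cast
      rfl
    have hn : ((‖kernelFun (r * toCircle t) s‖ ^ 2 : ℝ) : ℂ) =
        kernelFun (r * toCircle t) s * conj (kernelFun (r * toCircle t) s) := by
      rw [RCLike.mul_conj]; norm_cast
    rw [hn, hk, map_div₀, map_sub, map_one, Complex.conj_conj, Complex.conj_ofReal, div_mul_div_comm,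
      ← sq, hr2]
    field_simp
    ring
  · rw [hw, mul_pow, mul_pow, fourier_neg]
    simp [toCircle_nsmul]
  · have h3 : -(-((n : ℤ) + 1)) = ((n + 1 : ℕ) : ℤ) := by push_cast; ring
    have h4 : (-((n : ℤ) + 1)).natAbs = n + 1 := by omega
    have h5 : fourier (-((n : ℤ) + 1)) t = conj (fourier ((n + 1 : ℕ) : ℤ) t) := by
      rw [← fourier_neg]; congr 1
    rw [h3, h4, h5, ← pow_succ', hw]
    simp only [fourier_apply, natCast_zsmul, toCircle_nsmul, map_mul, Complex.conj_conj,
      Complex.conj_ofReal, Circle.coe_pow, map_pow, mul_pow]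

/-- The Poisson mean `∑ r^{|n|} f̂(n) e^{inθ}` of a bounded function. -/
def poissonMean (r : ℝ) (f : Linf) : C(Torus, ℂ) :=
  ∑' n : ℤ, ((r : ℂ) ^ n.natAbs * fourierCoeff f n) • fourier n

theorem summable_poissonMean {r : ℝ} (h0 : 0 ≤ r) (h1 : r < 1) (f : Linf) :
    Summable fun n : ℤ => ((r : ℂ) ^ n.natAbs * fourierCoeff f n) • (fourier n : C(Torus, ℂ)) := by
  refine Summable.of_norm_bounded ((summable_pow_natAbs h0 h1).mul_right ‖f‖) fun n => ?_
  rw [norm_smul, fourier_norm, mul_one, norm_mul, norm_pow, Complex.norm_real,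
    Real.norm_of_nonneg h0]
  gcongr
  exact norm_fourierCoeff_le f n

theorem poissonMean_add {r : ℝ} (h0 : 0 ≤ r) (h1 : r < 1) (f g : Linf) :
    poissonMean r (f + g) = poissonMean r f + poissonMean r g := by
  rw [poissonMean, poissonMean, poissonMean,
    ← (summable_poissonMean h0 h1 f).tsum_add (summable_poissonMean h0 h1 g)]
  refine tsum_congr fun n => ?_
  rw [← coeffL_apply, ← coeffL_apply, ← coeffL_apply, map_add, mul_add, add_smul]

theorem poissonMean_smul (r : ℝ) (c : ℂ) (f : Linf) :
    poissonMean r (c • f) = c • poissonMean r f := by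
  rw [poissonMean, poissonMean, ← tsum_const_smul'']
  refine tsum_congr fun n => ?_
  rw [← coeffL_apply, ← coeffL_apply, map_smul, smul_smul]
  congr 1
  rw [smul_eq_mul]; ring

theorem poissonMean_expInf (r : ℝ) (n : ℤ) :
    poissonMean r (expInf n) = (r : ℂ) ^ n.natAbs • fourier n := by
  rw [poissonMean, tsum_eq_single n]
  · rw [fourierCoeff_expInf, if_pos rfl, mul_one]
  · intro m hm
    rw [fourierCoeff_expInf, if_neg hm, mul_zero, zero_smul]

/-- The Poisson mean is the average against the squared modulus of the reproducing kernel. -/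
theorem poissonMean_apply {r : ℝ} (h0 : 0 ≤ r) (h1 : r < 1) (f : Linf) (t : Torus) :
    poissonMean r f t = inner ℂ (kernelPlus (r * toCircle t))
      (mulOp f (kernelPlus (r * toCircle t))) := by
  have hA := (summable_poissonMean h0 h1 f).hasSum.mapL (ContinuousMap.evalCLM ℂ t)
  let p : C(Torus, ℂ) := ⟨fun s => ((‖kernelFun (r * toCircle t) s‖ ^ 2 : ℝ) : ℂ), by fun_prop⟩
  have hs : Summable fun n : ℤ => ((r : ℂ) ^ n.natAbs * fourier n t) •
      (fourier (-n) : C(Torus, ℂ)) := by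
    refine Summable.of_norm_bounded (summable_pow_natAbs h0 h1) fun n => ?_
    rw [norm_smul, fourier_norm, mul_one, norm_mul, norm_pow, Complex.norm_real,
      Real.norm_of_nonneg h0, fourier_apply, Circle.norm_coe, mul_one]
  have hp : HasSum (fun n : ℤ => ((r : ℂ) ^ n.natAbs * fourier n t) •
      (fourier (-n) : C(Torus, ℂ))) p := by
    convert hs.hasSum using 1
    ext s
    exact (hasSum_norm_sq_kernelFun h0 h1 t s).unique (hs.hasSum.mapL (ContinuousMap.evalCLM ℂ s))
  -- Pairing the uniformly convergent kernel series with `f` through continuous linear maps replaces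
  -- an exchange of sum and integral.
  have hB := ((hp.mapL (ContinuousMap.toLp 2 arcLength ℂ)).mapL (mulOp f)).mapL
    (innerSL ℂ (expL2 0))
  have hC : inner ℂ (expL2 0) (mulOp f (ContinuousMap.toLp 2 arcLength ℂ p)) =
      inner ℂ (kernelPlus (r * toCircle t)) (mulOp f (kernelPlus (r * toCircle t))) := by
    rw [inner_mulOp_kernelPlus, L2.inner_def]
    apply integral_congr_ae
    filter_upwards [coeFn_mulOp f (ContinuousMap.toLp 2 arcLength ℂ p),
      coeFn_fourierLp (T := 2 * Real.pi) 2 0,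
      ContinuousMap.coeFn_toLp (p := 2) (𝕜 := ℂ) arcLength p] with s h₁ h₂ h₃
    rw [h₁, h₂, h₃, RCLike.inner_apply, fourier_zero, map_one, mul_one]
    rfl
  rw [← hC]
  refine hA.unique (hB.congr_fun fun n => ?_)
  rw [map_smul, map_smul, map_smul, map_smul, innerSL_apply_apply]
  change _ • fourier n t = _ • inner ℂ (expL2 0) (mulOp f (expL2 (-n)))
  rw [inner_mulOp_expL2, zero_sub, neg_neg, smul_eq_mul, smul_eq_mul]
  ring

/-- The squared norm is the Poisson mean of the constant `1`. -/
theorem norm_kernelPlus {r : ℝ} (h0 : 0 ≤ r) (h1 : r < 1) (t : Torus) :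
    ‖kernelPlus (r * toCircle t)‖ = 1 := by
  have h := poissonMean_apply h0 h1 1 t
  rw [← expInf_zero, poissonMean_expInf, expInf_zero, mulOp_one, one_apply_eq_self,
    inner_self_eq_norm_sq_to_K] at h
  have h2 : ‖kernelPlus (r * toCircle t)‖ ^ 2 = 1 := by
    have h3 : (1 : ℂ) = ((‖kernelPlus (r * toCircle t)‖ : ℝ) : ℂ) ^ 2 := by simpa using h
    exact_mod_cast h3.symm
  exact (pow_eq_one_iff_of_nonneg (norm_nonneg _) two_ne_zero).mp h2

theorem norm_kernelMinus {r : ℝ} (h0 : 0 ≤ r) (h1 : r < 1) (t : Torus) :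
    ‖kernelMinus (r * toCircle t)‖ = 1 := by
  have h := inner_mulOp_kernelMinus 1 (r * toCircle t)
  rw [mulOp_one, one_apply_eq_self, one_apply_eq_self, inner_self_eq_norm_sq_to_K,
    inner_self_eq_norm_sq_to_K, norm_kernelPlus h0 h1] at h
  have h2 : ‖kernelMinus (r * toCircle t)‖ ^ 2 = 1 := by
    have h3 : ((‖kernelMinus (r * toCircle t)‖ : ℝ) : ℂ) ^ 2 = 1 := by simpa using h
    exact_mod_cast h3
  exact (pow_eq_one_iff_of_nonneg (norm_nonneg _) two_ne_zero).mp h2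

theorem norm_poissonMean_le {r : ℝ} (h0 : 0 ≤ r) (h1 : r < 1) (f : Linf) :
    ‖poissonMean r f‖ ≤ ‖f‖ := by
  refine (ContinuousMap.norm_le _ (norm_nonneg _)).mpr fun t => ?_
  rw [poissonMean_apply h0 h1]
  refine (norm_inner_le_norm _ _).trans ?_
  rw [norm_kernelPlus h0 h1, one_mul]
  simpa [norm_kernelPlus h0 h1] using
    ContinuousLinearMap.le_of_opNorm_le _ (norm_mulOp_le f) (kernelPlus (r * toCircle t))

theorem eventually_mem_Ico : ∀ᶠ r : ℝ in 𝓝[<] 1, 0 ≤ r ∧ r < 1 := by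
  filter_upwards [Ioo_mem_nhdsLT (zero_lt_one : (0 : ℝ) < 1)] with r hr
  exact ⟨hr.1.le, hr.2⟩

theorem tendsto_sqrt_one_sub_sq : Tendsto (fun r : ℝ => Real.sqrt (1 - r ^ 2)) (𝓝[<] 1) (𝓝 0) := by
  have h : Continuous fun r : ℝ => Real.sqrt (1 - r ^ 2) := by fun_prop
  simpa using (h.tendsto 1).mono_left nhdsWithin_le_nhds

theorem tendsto_compact_kernelPlus {K : BL2} (hK : K ∈ compactSub) (t : Torus) :
    Tendsto (fun r : ℝ => K (kernelPlus (r * toCircle t))) (𝓝[<] 1) (𝓝 0) := by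
  refine tendsto_compact_of_inner ?_ (fun m => ?_) hK
  · filter_upwards [eventually_mem_Ico] with r hr using (norm_kernelPlus hr.1 hr.2 t).le
  · refine squeeze_zero_norm' ?_ tendsto_sqrt_one_sub_sq
    filter_upwards [eventually_mem_Ico] with r hr
    have hz := norm_mul_toCircle hr.1 t
    have := norm_inner_kernelPlus_le (z := r * toCircle t) (by rw [hz]; exact hr.2) m
    rwa [hz] at this

theorem tendsto_compact_kernelMinus {K : BL2} (hK : K ∈ compactSub) (t : Torus) :
    Tendsto (fun r : ℝ => K (kernelMinus (r * toCircle t))) (𝓝[<] 1) (𝓝 0) := by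
  refine tendsto_compact_of_inner ?_ (fun m => ?_) hK
  · filter_upwards [eventually_mem_Ico] with r hr using (norm_kernelMinus hr.1 hr.2 t).le
  · refine squeeze_zero_norm' ?_ tendsto_sqrt_one_sub_sq
    filter_upwards [eventually_mem_Ico] with r hr
    have hz := norm_mul_toCircle hr.1 t
    rw [inner_kernelMinus, RCLike.norm_conj]
    have := norm_inner_kernelPlus_le (z := r * toCircle t) (by rw [hz]; exact hr.2) (-1 - m)
    rwa [hz] at this

/-! ### The algebra `H^∞ + C` -/

theorem coeff_add (f g : Linf) (n : ℤ) :
    fourierCoeff (f + g : Linf) n = fourierCoeff f n + fourierCoeff g n := by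
  simp only [← coeffL_apply, map_add]

theorem coeff_sub (f g : Linf) (n : ℤ) :
    fourierCoeff (f - g : Linf) n = fourierCoeff f n - fourierCoeff g n := by
  simp only [← coeffL_apply, map_sub]

theorem coeff_smul (c : ℂ) (f : Linf) (n : ℤ) :
    fourierCoeff (c • f : Linf) n = c * fourierCoeff f n := by
  simp only [← coeffL_apply, map_smul, smul_eq_mul]

/-- `H^∞` as a subspace of `L^∞`. -/
def hinfSub : Submodule ℂ Linf where
  carrier := Hinf
  add_mem' {f g} hf hg n hn := by rw [coeff_add, hf n hn, hg n hn, add_zero]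
  zero_mem' := zero_mem_Hinf
  smul_mem' c f hf n hn := by rw [coeff_smul, hf n hn, mul_zero]

theorem isClosed_hinfSub : IsClosed (hinfSub : Set Linf) := by
  have h : (hinfSub : Set Linf) = ⋂ n : ℤ, ⋂ _ : n < 0, {f | coeffL n f = 0} := by
    ext f
    simp only [Set.mem_iInter, Set.mem_ofPred_eq, coeffL_apply]
    rfl
  rw [h]
  exact isClosed_iInter fun n => isClosed_iInter fun _ =>
    isClosed_eq (coeffL n).continuous continuous_const

instance : CompleteSpace hinfSub := isClosed_hinfSub.completeSpace_coe

theorem expInf_mem_hinfSub {n : ℤ} (hn : 0 ≤ n) : expInf n ∈ hinfSub := fun m hm => by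
  rw [fourierCoeff_expInf, if_neg (by omega)]

/-- The embedding of `C(𝕋)` into `L^∞`. -/
def ofCont : C(Torus, ℂ) →L[ℂ] Linf := ContinuousMap.toLp ∞ arcLength ℂ

theorem coeFn_ofCont (c : C(Torus, ℂ)) : ⇑(ofCont c) =ᵐ[arcLength] c :=
  ContinuousMap.coeFn_toLp arcLength c

theorem ofCont_fourier (n : ℤ) : ofCont (fourier n) = expInf n := rfl

theorem mem_contFun_iff {f : Linf} : f ∈ contFun ↔ ∃ c, ofCont c = f :=
  ⟨fun ⟨c, hc⟩ => ⟨c, Lp.ext ((coeFn_ofCont c).trans hc.symm)⟩,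
    fun ⟨c, hc⟩ => ⟨c, hc ▸ coeFn_ofCont c⟩⟩

theorem norm_ofCont_le (c : C(Torus, ℂ)) : ‖ofCont c‖ ≤ ‖c‖ :=
  linf_norm_le_of_ae (norm_nonneg _) (by
    filter_upwards [coeFn_ofCont c] with t ht
    rw [ht]; exact c.norm_coe_le_norm t)

theorem contFun_mul {f g : Linf} (hf : f ∈ contFun) (hg : g ∈ contFun) : f * g ∈ contFun := by
  obtain ⟨c, hc⟩ := hf
  obtain ⟨d, hd⟩ := hg
  refine ⟨c * d, ?_⟩
  filter_upwards [coeFn_mul f g, hc, hd] with t h₁ h₂ h₃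
  rw [h₁, h₂, h₃]; rfl

/-- `H^∞ + C` as a subspace of `L^∞`. -/
def hinfPlusCSub : Submodule ℂ Linf := hinfSub ⊔ (ofCont : C(Torus, ℂ) →ₗ[ℂ] Linf).range

theorem mem_hinfPlusCSub {f : Linf} : f ∈ hinfPlusCSub ↔ f ∈ HinfPlusC := by
  rw [hinfPlusCSub, Submodule.mem_sup]
  constructor
  · rintro ⟨h, hh, _, ⟨c, rfl⟩, rfl⟩
    exact ⟨h, hh, ofCont c, mem_contFun_iff.mpr ⟨c, rfl⟩, rfl⟩
  · rintro ⟨h, hh, c, hc, rfl⟩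
    obtain ⟨c, rfl⟩ := mem_contFun_iff.mp hc
    exact ⟨h, hh, ofCont c, ⟨c, rfl⟩, rfl⟩

theorem hinfSub_le : hinfSub ≤ hinfPlusCSub := le_sup_left

theorem mem_hinfPlusCSub_of_contFun {f : Linf} (hf : f ∈ contFun) : f ∈ hinfPlusCSub :=
  mem_hinfPlusCSub.mpr (contFun_subset hf)

theorem poissonMean_mem_hinfSub {r : ℝ} (h0 : 0 ≤ r) (h1 : r < 1) {f : Linf} (hf : f ∈ hinfSub) :
    ofCont (poissonMean r f) ∈ hinfSub := by
  have h := (summable_poissonMean h0 h1 f).hasSum.mapL ofCont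
  refine isClosed_hinfSub.mem_of_tendsto h (Eventually.of_forall fun s => ?_)
  refine hinfSub.sum_mem fun n _ => ?_
  rw [map_smul, ofCont_fourier]
  rcases lt_or_ge n 0 with hn | hn
  · rw [hf n hn, mul_zero, zero_smul]; exact zero_mem _
  · exact hinfSub.smul_mem _ (expInf_mem_hinfSub hn)

/-- The means are contractions, so the functions with uniform convergence form a closed subspace; it
contains the exponentials, on which the mean is multiplication by `r^{|n|}`. -/
theorem tendsto_poissonMean (c : C(Torus, ℂ)) :
    Tendsto (fun r => poissonMean r (ofCont c)) (𝓝[<] 1) (𝓝 c) := by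
  let S : Submodule ℂ C(Torus, ℂ) :=
    { carrier := {c | Tendsto (fun r => poissonMean r (ofCont c)) (𝓝[<] 1) (𝓝 c)}
      add_mem' := fun {a b} ha hb => by
        refine (Tendsto.add ha hb).congr' ?_
        filter_upwards [eventually_mem_Ico] with r hr
        rw [map_add, poissonMean_add hr.1 hr.2]
      zero_mem' := by
        refine tendsto_const_nhds.congr fun r => ?_
        have := poissonMean_smul r 0 0
        rwa [zero_smul, zero_smul, eq_comm, ← map_zero ofCont] at this
      smul_mem' := fun a c hc => by
        refine (Tendsto.const_smul hc a).congr fun r => ?_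
        rw [map_smul, poissonMean_smul] }
  have hS : IsClosed (S : Set C(Torus, ℂ)) := by
    refine isClosed_of_closure_subset fun c hc => ?_
    change Tendsto (fun r => poissonMean r (ofCont c)) (𝓝[<] 1) (𝓝 c)
    rw [Metric.tendsto_nhds]
    intro ε hε
    obtain ⟨d, hd, hcd⟩ := Metric.mem_closure_iff.mp hc (ε / 3) (by positivity)
    filter_upwards [eventually_mem_Ico, Metric.tendsto_nhds.mp hd (ε / 3) (by positivity)]
      with r hr hr'
    rw [dist_eq_norm] at hcd hr' ⊢
    have h1 : poissonMean r (ofCont c) - c = poissonMean r (ofCont (c - d)) +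
        (poissonMean r (ofCont d) - d) - (c - d) := by
      have h2 : ofCont c = ofCont (c - d) + ofCont d := by rw [map_sub, sub_add_cancel]
      rw [h2, poissonMean_add hr.1 hr.2]; abel
    have h3 := (norm_poissonMean_le hr.1 hr.2 (ofCont (c - d))).trans (norm_ofCont_le _)
    rw [h1]
    linarith [norm_sub_le (poissonMean r (ofCont (c - d)) + (poissonMean r (ofCont d) - d)) (c - d),
      norm_add_le (poissonMean r (ofCont (c - d))) (poissonMean r (ofCont d) - d)]
  have hle : (Submodule.span ℂ (Set.range (@fourier (2 * Real.pi)))).topologicalClosure ≤ S := by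
    refine Submodule.topologicalClosure_minimal _ (Submodule.span_le.mpr ?_) hS
    rintro _ ⟨n, rfl⟩
    change Tendsto (fun r => poissonMean r (expInf n)) (𝓝[<] 1) (𝓝 (fourier n))
    simp only [poissonMean_expInf]
    have h : Continuous fun r : ℝ => (r : ℂ) ^ n.natAbs • (fourier n : C(Torus, ℂ)) := by fun_prop
    simpa using (h.tendsto 1).mono_left nhdsWithin_le_nhds
  rw [span_fourier_closure_eq_top] at hle
  exact hle (Submodule.mem_top (x := c))

/-- Addition `C(𝕋) × H^∞ → L^∞`. -/
def sumHom : NormedAddGroupHom (C(Torus, ℂ) × hinfSub) Linf :=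
  (ofCont.coprod hinfSub.subtypeL).toLinearMap.toAddMonoidHom.mkNormedAddGroupHom
    ‖ofCont.coprod hinfSub.subtypeL‖ fun x => (ofCont.coprod hinfSub.subtypeL).le_opNorm x

theorem sumHom_apply (x : C(Torus, ℂ) × hinfSub) : sumHom x = ofCont x.1 + x.2 := rfl

/-- A decomposition with norms controlled by `‖x‖` alone. From any `x = z + y`, with `z` in `H^∞`
and `y` continuous, pass to `x = (z - z_r) + (y - y_r + x_r)`, where the subscript denotes Poisson
means. These preserve `H^∞` and are continuous functions. Choosing `r` with `‖y - y_r‖ < ‖x‖` bounds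
the continuous part by `2‖x‖`, hence the analytic part by `3‖x‖`. -/
theorem sumHom_surjectiveOnWith :
    sumHom.SurjectiveOnWith hinfPlusCSub.toAddSubgroup 3 := by
  intro x hx
  by_cases hx0 : x = 0
  · exact ⟨0, by simp [hx0], by simp [hx0]⟩
  have hpos : 0 < ‖x‖ := norm_pos_iff.mpr hx0
  obtain ⟨z, hz, _, ⟨y, rfl⟩, hzy⟩ := Submodule.mem_sup.mp hx
  obtain ⟨r, hr, hr'⟩ := (eventually_mem_Ico.and
    (Metric.tendsto_nhds.mp (tendsto_poissonMean y) ‖x‖ hpos)).exists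
  rw [dist_comm, dist_eq_norm] at hr'
  change z + ofCont y = x at hzy
  have h1 : poissonMean r x = poissonMean r z + poissonMean r (ofCont y) := by
    rw [← hzy, poissonMean_add hr.1 hr.2]
  have hsum : ofCont (y - poissonMean r (ofCont y) + poissonMean r x) +
      (z - ofCont (poissonMean r z)) = x := by
    rw [h1, map_add, map_sub, map_add, ← hzy]; abel
  have hd : ‖y - poissonMean r (ofCont y) + poissonMean r x‖ ≤ 2 * ‖x‖ := by
    linarith [norm_add_le (y - poissonMean r (ofCont y)) (poissonMean r x),
      norm_poissonMean_le hr.1 hr.2 x]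
  refine ⟨(y - poissonMean r (ofCont y) + poissonMean r x,
    ⟨z - ofCont (poissonMean r z), sub_mem hz (poissonMean_mem_hinfSub hr.1 hr.2 hz)⟩), hsum, ?_⟩
  refine max_le (hd.trans (by linarith)) ?_
  change ‖z - ofCont (poissonMean r z)‖ ≤ _
  have h2 : z - ofCont (poissonMean r z) =
      x - ofCont (y - poissonMean r (ofCont y) + poissonMean r x) := by
    rw [eq_sub_iff_add_eq', hsum]
  rw [h2]
  linarith [norm_sub_le x (ofCont (y - poissonMean r (ofCont y) + poissonMean r x)),
    norm_ofCont_le (y - poissonMean r (ofCont y) + poissonMean r x)]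

/-- Sarason's theorem: `H^∞ + C` is closed. -/
theorem isClosed_hinfPlusCSub : IsClosed (hinfPlusCSub : Set Linf) := by
  refine isClosed_of_closure_subset fun x hx => ?_
  -- Since `C(𝕋) × H^∞` is complete, controlled preimages of the terms of a rapidly convergent
  -- series can be summed, so every point of the closure is attained.
  obtain ⟨g, hg, -⟩ := controlled_closure_of_complete (ε := 1) (by norm_num : (0 : ℝ) < 3) one_pos
    sumHom_surjectiveOnWith x hx
  rw [← hg, sumHom_apply]
  exact add_mem (mem_hinfPlusCSub_of_contFun (mem_contFun_iff.mpr ⟨_, rfl⟩)) (hinfSub_le g.2.2)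

/-- The possibly nonzero matrix entries of the Hankel operator are the coefficients of index `n - m`
with `n < 0 ≤ m`, all negative; the column `m = 0` already contains every negative index. -/
theorem mem_hinfSub_iff {f : Linf} : f ∈ hinfSub ↔ Pminus * mulOp f * Pplus = 0 := by
  constructor
  · intro hf
    refine op_ext fun m => eq_of_inner_expL2 fun n => ?_
    rw [mul_apply_eq_comp, mul_apply_eq_comp, Pplus_expL2, ← inner_Pminus, Pminus_expL2]
    split_ifs with h1 h2
    · simp
    · simp
    · rw [inner_mulOp_expL2, hf _ (by omega)]; simp
    · simp
  · intro h n hn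
    have h1 : inner ℂ (expL2 n) ((Pminus * mulOp f * Pplus) (expL2 0)) = 0 := by
      rw [h]; simp
    rwa [mul_apply_eq_comp, mul_apply_eq_comp, Pplus_expL2, if_pos le_rfl, ← inner_Pminus,
      Pminus_expL2, if_neg (not_le.mpr hn), inner_mulOp_expL2, sub_zero] at h1

/-- Insert `P₊ + P₋ = 1` between the factors. Each term contains a Hankel operator of `f` or `g`, so
vanishing and compactness both pass to products. -/
theorem hankel_mul (f g : Linf) : Pminus * mulOp (f * g) * Pplus =
    Pminus * mulOp f * Pplus * (Pplus * mulOp g * Pplus) +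
      Pminus * mulOp f * Pminus * (Pminus * mulOp g * Pplus) := by
  have h : Pminus * mulOp (f * g) * Pplus =
      Pminus * mulOp f * (Pplus + Pminus) * mulOp g * Pplus := by
    rw [Pplus_add_Pminus, mul_one, mulOp_mul]; simp only [mul_assoc]
  have h1 : ∀ A : BL2, Pplus * (Pplus * A) = Pplus * A := fun A => by
    rw [← mul_assoc, Pplus_mul_Pplus]
  have h2 : ∀ A : BL2, Pminus * (Pminus * A) = Pminus * A := fun A => by
    rw [← mul_assoc, Pminus_mul_Pminus]
  rw [h]
  simp only [mul_add, add_mul, mul_assoc, h1, h2]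

theorem hinfSub_mul {f g : Linf} (hf : f ∈ hinfSub) (hg : g ∈ hinfSub) : f * g ∈ hinfSub := by
  rw [mem_hinfSub_iff] at *
  rw [hankel_mul, hf, hg, zero_mul, mul_zero, add_zero]

/-- The multipliers of `H^∞ + C`. -/
def multipliers : Submodule ℂ Linf where
  carrier := {c | ∀ x ∈ hinfPlusCSub, x * c ∈ hinfPlusCSub}
  add_mem' {a b} ha hb x hx := by rw [mul_add]; exact add_mem (ha x hx) (hb x hx)
  zero_mem' x _ := by rw [mul_zero]; exact zero_mem _
  smul_mem' c a ha x hx := by rw [mul_smul_comm]; exact hinfPlusCSub.smul_mem _ (ha x hx)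

theorem multipliers_mul {a b : Linf} (ha : a ∈ multipliers) (hb : b ∈ multipliers) :
    a * b ∈ multipliers := fun x hx => by
  rw [← mul_assoc]; exact hb _ (ha x hx)

theorem isClosed_multipliers : IsClosed (multipliers : Set Linf) := by
  have h : (multipliers : Set Linf) =
      ⋂ x : Linf, ⋂ _ : x ∈ hinfPlusCSub, {c | x * c ∈ hinfPlusCSub} := by
    ext c; simp only [Set.mem_iInter]; rfl
  rw [h]
  exact isClosed_iInter fun x => isClosed_iInter fun _ =>
    isClosed_hinfPlusCSub.preimage (continuous_linf_mul_left x)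

theorem mem_multipliers_of_contFun {c : Linf} (hc : c ∈ contFun)
    (h : ∀ x ∈ hinfSub, x * c ∈ hinfPlusCSub) : c ∈ multipliers := by
  intro x hx
  obtain ⟨z, hz, y, hy, rfl⟩ := mem_hinfPlusCSub.mp hx
  rw [add_mul]
  exact add_mem (h z hz) (mem_hinfPlusCSub_of_contFun (contFun_mul hy hc))

/-- Multiplying an `H^∞` function by `e^{-iθ}` moves only the coefficient of index `0` to a negative
index; subtracting that single exponential returns to `H^∞`. Other negative powers follow by
iteration. -/
theorem expInf_mem_multipliers (n : ℤ) : expInf n ∈ multipliers := by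
  have hpos : ∀ n : ℤ, 0 ≤ n → expInf n ∈ multipliers := fun n hn =>
    mem_multipliers_of_contFun (expInf_mem_contFun n) fun x hx =>
      hinfSub_le (hinfSub_mul hx (expInf_mem_hinfSub hn))
  have hneg : expInf (-1) ∈ multipliers := by
    refine mem_multipliers_of_contFun (expInf_mem_contFun _) fun x hx => ?_
    rw [← sub_add_cancel (x * expInf (-1)) (fourierCoeff x 0 • expInf (-1))]
    refine add_mem (hinfSub_le fun n hn => ?_) (hinfPlusCSub.smul_mem _
      (mem_hinfPlusCSub_of_contFun (expInf_mem_contFun _)))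
    rw [coeff_sub, coeff_smul, fourierCoeff_mul_expInf, fourierCoeff_expInf]
    split_ifs with h
    · rw [h, sub_self, mul_one, sub_self]
    · rw [hx _ (by omega), mul_zero, sub_zero]
  rcases le_or_gt 0 n with hn | hn
  · exact hpos n hn
  · obtain ⟨k, rfl⟩ : ∃ k : ℕ, n = -k := ⟨n.natAbs, by omega⟩
    clear hn
    induction k with
    | zero => exact hpos _ (by simp)
    | succ k ih =>
      have : expInf (-((k + 1 : ℕ) : ℤ)) = expInf (-k) * expInf (-1) := by
        rw [expInf_mul]; congr 1; push_cast; ring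
      rw [this]
      exact multipliers_mul ih hneg

/-- Only the products of an analytic and a continuous part need an argument: the multipliers form a
closed subspace containing the exponentials, hence all of `C(𝕋)`. -/
theorem hinfPlusCSub_mul {f g : Linf} (hf : f ∈ hinfPlusCSub) (hg : g ∈ hinfPlusCSub) :
    f * g ∈ hinfPlusCSub := by
  have hc : contFun ⊆ multipliers :=
    contFun_subset_of_expInf_mem isClosed_multipliers expInf_mem_multipliers
  obtain ⟨z, hz, y, hy, rfl⟩ := mem_hinfPlusCSub.mp hg
  obtain ⟨z', hz', y', hy', rfl⟩ := mem_hinfPlusCSub.mp hf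
  rw [mul_add]
  refine add_mem ?_ (hc hy _ hf)
  rw [add_mul, mul_comm y' z]
  exact add_mem (hinfSub_le (hinfSub_mul hz' hz)) (hc hy' _ (hinfSub_le hz))

/-! ### The algebra `QC` -/

instance : StarModule ℂ Linf := ⟨linf_star_smul⟩

/-- `QC` as a star subalgebra of `L^∞`. -/
def qcAlg : StarSubalgebra ℂ Linf where
  carrier := QC
  mul_mem' {f g} hf hg := by
    refine ⟨mem_hinfPlusCSub.mp (hinfPlusCSub_mul (mem_hinfPlusCSub.mpr hf.1)
      (mem_hinfPlusCSub.mpr hg.1)), ?_⟩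
    rw [star_mul]
    exact mem_hinfPlusCSub.mp (hinfPlusCSub_mul (mem_hinfPlusCSub.mpr hg.2)
      (mem_hinfPlusCSub.mpr hf.2))
  add_mem' {f g} hf hg := by
    refine ⟨mem_hinfPlusCSub.mp (add_mem (mem_hinfPlusCSub.mpr hf.1)
      (mem_hinfPlusCSub.mpr hg.1)), ?_⟩
    rw [star_add]
    exact mem_hinfPlusCSub.mp (add_mem (mem_hinfPlusCSub.mpr hf.2) (mem_hinfPlusCSub.mpr hg.2))
  algebraMap_mem' c := by
    rw [Algebra.algebraMap_eq_smul_one]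
    exact contFun_subset_QC (const_mem_contFun c)
  star_mem' hf := star_mem_QC hf

theorem mem_qcAlg {f : Linf} : f ∈ qcAlg ↔ f ∈ QC := Iff.rfl

theorem sub_mem_QC {f g : Linf} (hf : f ∈ QC) (hg : g ∈ QC) : f - g ∈ QC :=
  sub_mem (H := qcAlg) hf hg

theorem isClosed_QC : IsClosed QC := by
  have h : QC = (hinfPlusCSub : Set Linf) ∩ star ⁻¹' (hinfPlusCSub : Set Linf) := by
    ext f
    exact and_congr mem_hinfPlusCSub.symm mem_hinfPlusCSub.symm
  rw [h]
  exact isClosed_hinfPlusCSub.inter (isClosed_hinfPlusCSub.preimage continuous_linf_star)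

theorem norm_pow_le_of_norm_le {q : Linf} {κ : ℝ} (hq : ‖q‖ ≤ κ) (n : ℕ) : ‖q ^ n‖ ≤ κ ^ n := by
  induction n with
  | zero => simpa using linf_norm_one_le
  | succ n ih =>
    rw [pow_succ, pow_succ]
    exact (linf_norm_mul_le _ _).trans (mul_le_mul ih hq (norm_nonneg _)
      (pow_nonneg ((norm_nonneg _).trans hq) _))

/-- A quasicontinuous function that is bounded below is invertible in `QC`. -/
theorem invertibleInQC_of_le {f : Linf} (hf : f ∈ QC) {δ : ℝ} (hδ : 0 < δ)
    (h : ∀ᵐ t ∂arcLength, δ ≤ ‖f t‖) : InvertibleInQC f := by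
  have hM : δ ≤ ‖f‖ := by
    obtain ⟨t, h1, h2⟩ := (h.and (linf_ae_norm_le f)).exists
    exact h1.trans h2
  have hMpos : 0 < ‖f‖ := hδ.trans_le hM
  have hmem : MemLp (fun t => (f t)⁻¹) ∞ arcLength := by
    refine memLp_top_of_bound (Lp.aestronglyMeasurable f).inv₀ δ⁻¹ ?_
    filter_upwards [h] with t ht
    rw [norm_inv]
    exact inv_anti₀ hδ ht
  set G : Linf := hmem.toLp _ with hG
  have hfG : f * G = 1 := by
    apply Lp.ext
    filter_upwards [coeFn_mul f G, coeFn_one, hmem.coeFn_toLp, h] with t h₁ h₂ h₃ h₄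
    rw [h₁, h₂, hG, h₃]
    exact mul_inv_cancel₀ (norm_pos_iff.mp (hδ.trans_le h₄))
  -- The function `q = 1 - |f|² / ‖f‖²` has values in `[0, κ]` with `κ < 1`, and `1 - q = c f̄ f`.
  -- So `1 / f = c f̄ ∑ qⁱ` is a norm convergent series in `QC`.
  set c : ℂ := (((‖f‖ ^ 2)⁻¹ : ℝ) : ℂ) with hc
  set q : Linf := 1 - c • (star f * f) with hq
  set κ : ℝ := 1 - (‖f‖ ^ 2)⁻¹ * δ ^ 2 with hκ
  have hκ0 : 0 ≤ κ := by
    rw [hκ, sub_nonneg, inv_mul_le_iff₀ (by positivity), mul_one]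
    gcongr
  have hκ1 : κ < 1 := by
    rw [hκ, sub_lt_self_iff]; positivity
  have hqκ : ‖q‖ ≤ κ := by
    refine linf_norm_le_of_ae hκ0 ?_
    filter_upwards [Lp.coeFn_sub (1 : Linf) (c • (star f * f)), coeFn_one,
      Lp.coeFn_smul c (star f * f), coeFn_mul (star f) f, coeFn_star f, h, linf_ae_norm_le f]
      with t h₁ h₂ h₃ h₄ h₅ h₆ h₇
    have hv : q t = ((1 - (‖f‖ ^ 2)⁻¹ * ‖f t‖ ^ 2 : ℝ) : ℂ) := by
      rw [hq, h₁, Pi.sub_apply, h₂, h₃, Pi.smul_apply, h₄, h₅, RCLike.conj_mul, hc, smul_eq_mul]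
      push_cast
      rfl
    rw [hv, Complex.norm_real, Real.norm_of_nonneg]
    · rw [hκ]
      gcongr
    · rw [sub_nonneg, inv_mul_le_iff₀ (by positivity), mul_one]
      gcongr
  have hqQC : q ∈ qcAlg := sub_mem (one_mem _) (qcAlg.smul_mem
    (mul_mem (star_mem (s := qcAlg) hf) (mem_qcAlg.mpr hf)) c)
  have hlim : Tendsto (fun n : ℕ => c • (star f * ∑ i ∈ Finset.range n, q ^ i)) atTop (𝓝 G) := by
    rw [tendsto_iff_norm_sub_tendsto_zero]
    have hz : Tendsto (fun n : ℕ => κ ^ n * ‖G‖) atTop (𝓝 0) := by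
      simpa using (tendsto_pow_atTop_nhds_zero_of_lt_one hκ0 hκ1).mul_const ‖G‖
    refine squeeze_zero (fun _ => norm_nonneg _) (fun n => ?_) hz
    have h1 : c • (star f * ∑ i ∈ Finset.range n, q ^ i) - G = -(q ^ n * G) := by
      have h2 := geom_sum_mul_neg q n
      have h3 : c • (star f * ∑ i ∈ Finset.range n, q ^ i) =
          (∑ i ∈ Finset.range n, q ^ i) * (1 - q) * G := by
        have h4 : (1 - q) * G = c • star f := by
          rw [hq, sub_sub_cancel, smul_mul_assoc, mul_assoc, hfG, mul_one]
        rw [mul_assoc, h4, mul_smul_comm, mul_comm]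
      rw [h3, h2, sub_mul, one_mul]; ring
    rw [h1, norm_neg]
    refine (linf_norm_mul_le _ _).trans ?_
    gcongr
    exact norm_pow_le_of_norm_le hqκ n
  refine ⟨hf, G, isClosed_QC.mem_of_tendsto hlim (Eventually.of_forall fun n => ?_), hfG⟩
  exact qcAlg.smul_mem (mul_mem (star_mem (s := qcAlg) hf)
    (sum_mem fun i _ => pow_mem hqQC i)) c

theorem exists_le_of_mul_eq_one {f h : Linf} (hfh : f * h = 1) :
    ∃ δ : ℝ, 0 < δ ∧ ∀ᵐ t ∂arcLength, δ ≤ ‖f t‖ := by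
  refine ⟨(‖h‖ + 1)⁻¹, by positivity, ?_⟩
  have h1 := coeFn_mul f h
  rw [hfh] at h1
  filter_upwards [h1, coeFn_one, linf_ae_norm_le h] with t h₁ h₂ h₃
  rw [h₂] at h₁
  have h4 : 1 = ‖f t‖ * ‖h t‖ := by rw [← norm_mul, ← h₁, norm_one]
  rw [inv_le_iff_one_le_mul₀ (by positivity)]
  nlinarith [norm_nonneg (f t)]

/-! ### Compactness of Hankel operators -/

/-- The symbols whose Hankel operator is compact. -/
def compactHankel : Submodule ℂ Linf where
  carrier := {f | Pminus * mulOp f * Pplus ∈ compactSub}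
  add_mem' {a b} ha hb := by
    change Pminus * mulOp (a + b) * Pplus ∈ compactSub
    rw [mulOp_add, mul_add, add_mul]; exact add_mem ha hb
  zero_mem' := by
    change Pminus * mulOp 0 * Pplus ∈ compactSub
    rw [mulOp_zero, mul_zero, zero_mul]; exact zero_mem _
  smul_mem' c a ha := by
    change Pminus * mulOp (c • a) * Pplus ∈ compactSub
    rw [mulOp_smul, mul_smul_comm, smul_mul_assoc]; exact compactSub.smul_mem c ha

theorem isClosed_compactHankel : IsClosed (compactHankel : Set Linf) :=
  isClosed_compactSub.preimage
    ((continuous_const.mul mulOpL.continuous).mul continuous_const :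
      Continuous fun f => Pminus * mulOpL f * Pplus)

theorem compactHankel_mul {f g : Linf} (hf : f ∈ compactHankel) (hg : g ∈ compactHankel) :
    f * g ∈ compactHankel := by
  change Pminus * mulOp (f * g) * Pplus ∈ compactSub
  rw [hankel_mul]
  exact add_mem (mul_mem_compactSub_right hf _) (mul_mem_compactSub_left _ hg)

theorem hinfSub_le_compactHankel : hinfSub ≤ compactHankel := fun f hf => by
  change Pminus * mulOp f * Pplus ∈ compactSub
  rw [mem_hinfSub_iff.mp hf]; exact zero_mem _

/-- Multiplication by `e^{-iθ}` pushes exactly one basis vector of `H²`, the constant, out of `H²`,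
so its Hankel operator has rank one. Products give the other negative powers. -/
theorem expInf_mem_compactHankel (n : ℤ) : expInf n ∈ compactHankel := by
  have hneg : expInf (-1) ∈ compactHankel := by
    change Pminus * mulOp (expInf (-1)) * Pplus ∈ compactSub
    have h : Pminus * mulOp (expInf (-1)) * Pplus = matUnit (-1) 0 := by
      refine op_ext fun m => ?_
      rw [mul_apply_eq_comp, mul_apply_eq_comp, Pplus_expL2, matUnit_apply, inner_expL2]
      split_ifs with h1 h2 h2
      · rw [mulOp_expInf, Pminus_expL2, if_neg (by omega), ← h2, add_zero, one_smul]
      · rw [mulOp_expInf, Pminus_expL2, if_pos (by omega), zero_smul]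
      · omega
      · simp
    rw [h]; exact matUnit_mem_compactSub _ _
  rcases le_or_gt 0 n with hn | hn
  · exact hinfSub_le_compactHankel (expInf_mem_hinfSub hn)
  · obtain ⟨k, rfl⟩ : ∃ k : ℕ, n = -k := ⟨n.natAbs, by omega⟩
    clear hn
    induction k with
    | zero => exact hinfSub_le_compactHankel (expInf_mem_hinfSub (by simp))
    | succ k ih =>
      have : expInf (-((k + 1 : ℕ) : ℤ)) = expInf (-k) * expInf (-1) := by
        rw [expInf_mul]; congr 1; push_cast; ring
      rw [this]
      exact compactHankel_mul ih hneg

/-- The analytic part contributes zero, and the continuous part is a uniform limit of trigonometric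
polynomials. -/
theorem compact_hankel {f : Linf} (hf : f ∈ QC) : Pminus * mulOp f * Pplus ∈ compactSub := by
  obtain ⟨h, hh, c, hc, rfl⟩ := hf.1
  exact compactHankel.add_mem (hinfSub_le_compactHankel hh)
    (contFun_subset_of_expInf_mem isClosed_compactHankel expInf_mem_compactHankel hc)

/-- This is the adjoint of the Hankel operator of `f̄`; here the invariance of `QC` under
conjugation enters. -/
theorem compact_hankel_star {f : Linf} (hf : f ∈ QC) : Pplus * mulOp f * Pminus ∈ compactSub := by
  have h := star_mem_compactSub (compact_hankel (star_mem_QC hf))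
  rwa [star_mul, star_mul, star_mulOp, star_star, star_Pplus, star_Pminus, ← mul_assoc] at h

/-- Splitting the identity between the factors leaves the error `-(P₊ f (P₋ g P₊) + P₋ ψ (P₊ φ
P₋))`, so compactness is needed only for the right-hand symbols. -/
theorem diagOp_mul_sub_mem {f g ψ φ : Linf} (hg : g ∈ QC) (hφ : φ ∈ QC) :
    diagOp f ψ * diagOp g φ - diagOp (f * g) (ψ * φ) ∈ compactSub := by
  have hP : Pplus = 1 - Pminus := by rw [Pminus, sub_sub_cancel]
  have h1 : ∀ A : BL2, Pplus * (Pplus * A) = Pplus * A := fun A => by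
    rw [← mul_assoc, Pplus_mul_Pplus]
  have h2 : ∀ A : BL2, Pminus * (Pminus * A) = Pminus * A := fun A => by
    rw [← mul_assoc, Pminus_mul_Pminus]
  have h3 : ∀ A : BL2, Pplus * (Pminus * A) = 0 := fun A => by
    rw [← mul_assoc, Pplus_mul_Pminus, zero_mul]
  have h4 : ∀ A : BL2, Pminus * (Pplus * A) = 0 := fun A => by
    rw [← mul_assoc, Pminus_mul_Pplus, zero_mul]
  have h5 : mulOp (f * g) = mulOp f * Pplus * mulOp g + mulOp f * Pminus * mulOp g := by
    rw [← add_mul, ← mul_add, Pplus_add_Pminus, mul_one, mulOp_mul]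
  have h6 : mulOp (ψ * φ) = mulOp ψ * Pplus * mulOp φ + mulOp ψ * Pminus * mulOp φ := by
    rw [← add_mul, ← mul_add, Pplus_add_Pminus, mul_one, mulOp_mul]
  have h : diagOp f ψ * diagOp g φ - diagOp (f * g) (ψ * φ) =
      -(Pplus * mulOp f * (Pminus * mulOp g * Pplus) +
        Pminus * mulOp ψ * (Pplus * mulOp φ * Pminus)) := by
    simp only [diagOp, h5, h6, mul_add, add_mul, mul_assoc, h1, h2, h3, h4, mul_zero, add_zero,
      zero_add]
    abel
  rw [h]
  exact neg_mem (add_mem (mul_mem_compactSub_left _ (compact_hankel hg))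
    (mul_mem_compactSub_left _ (compact_hankel_star hφ)))

theorem gsio_sub_diagOp_mem {f φ g ψ : Linf} (hφ : φ ∈ QC) (hg : g ∈ QC) :
    gsio !![f, φ; g, ψ] - diagOp f ψ ∈ compactSub := by
  have h : gsio !![f, φ; g, ψ] - diagOp f ψ =
      Pminus * mulOp g * Pplus + Pplus * mulOp φ * Pminus := by
    simp only [gsio, diagOp, Matrix.of_apply, Matrix.cons_val', Matrix.cons_val_zero,
      Matrix.cons_val_one, Matrix.cons_val_fin_one]
    abel
  rw [h]
  exact add_mem (compact_hankel hg) (compact_hankel_star hφ)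

/-! ### Radial limits of Poisson integrals -/

/-- Chord against arc: for the representative `y` in `[-π, π]` the chord is `2 |sin (y / 2)|`, and
Jordan's inequality applies. -/
theorem two_div_pi_mul_norm_le (u : Torus) : 2 / Real.pi * ‖u‖ ≤ ‖(toCircle u : ℂ) - 1‖ := by
  induction u using QuotientAddGroup.induction_on with
  | H x =>
    have hT : (2 * Real.pi) ≠ 0 := Real.two_pi_pos.ne'
    set y : ℝ := x - round ((2 * Real.pi)⁻¹ * x) * (2 * Real.pi) with hy
    have hxy : ((x : ℝ) : Torus) = (y : Torus) := by
      rw [hy, AddCircle.coe_sub, eq_sub_iff_add_eq, add_eq_left]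
      rw [← zsmul_eq_mul, AddCircle.coe_zsmul, AddCircle.coe_period, smul_zero]
    have hnorm : ‖((x : ℝ) : Torus)‖ = |y| := AddCircle.norm_eq _
    have hle : |y| ≤ Real.pi := by
      have h := AddCircle.norm_le_half_period (2 * Real.pi) (x := ((x : ℝ) : Torus)) hT
      rw [hnorm, abs_of_pos Real.two_pi_pos] at h
      linarith
    change 2 / Real.pi * ‖((x : ℝ) : Torus)‖ ≤ ‖(toCircle ((x : ℝ) : Torus) : ℂ) - 1‖
    rw [hnorm, hxy, toCircle_apply_mk, div_self hT, one_mul, Circle.coe_exp, mul_comm (y : ℂ),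
      Complex.norm_exp_I_mul_ofReal_sub_one, Real.norm_eq_abs, abs_mul, abs_two]
    have h2 := Real.mul_abs_le_abs_sin (x := y / 2) (by rw [abs_div, abs_two]; linarith)
    rw [abs_div, abs_two] at h2
    linarith

/-- Dyadic decay of the Poisson kernel. With `k` least possible, either `k = 0` and `D ≥ 1 - r`
suffices, or `‖s - t‖ > 2^(k-1) (1 - r)` and `D ≥ ‖s - t‖ / π` gives the factor `4^k`. -/
theorem norm_sq_kernelFun_le {r : ℝ} (h0 : 0 ≤ r) (h1 : r < 1) (t s : Torus) :
    ∃ k : ℕ, ‖s - t‖ ≤ 2 ^ k * (1 - r) ∧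
      ‖kernelFun (r * toCircle t) s‖ ^ 2 ≤ 8 * Real.pi ^ 2 / (4 ^ k * (1 - r)) := by
  have hδ : 0 < 1 - r := by linarith
  set e : ℂ := ((toCircle (s - t) : Circle) : ℂ) with he
  have hne : ‖e‖ = 1 := Circle.norm_coe _
  set D : ℝ := ‖1 - r * e‖ with hD
  have hre : ‖(r : ℂ) * e‖ = r := by
    rw [norm_mul, hne, mul_one, Complex.norm_real, Real.norm_of_nonneg h0]
  have hD1 : 1 - r ≤ D := by
    have := norm_sub_norm_le (1 : ℂ) (r * e)
    rwa [norm_one, hre] at this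
  -- The chord satisfies `|e - 1| ≤ D + (1 - r) ≤ 2 D`.
  have hD2 : ‖s - t‖ / Real.pi ≤ D := by
    have h2 := two_div_pi_mul_norm_le (s - t)
    have h3 : (toCircle (s - t) : ℂ) - 1 = -(1 - r * e) + (1 - r : ℝ) * e := by
      rw [← he]; push_cast; ring
    have h4 : ‖((1 - r : ℝ) : ℂ) * e‖ = 1 - r := by
      rw [norm_mul, hne, mul_one, Complex.norm_real, Real.norm_of_nonneg hδ.le]
    have h5 := norm_add_le (-(1 - r * e)) ((1 - r : ℝ) * e)
    rw [← h3, norm_neg, h4] at h5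
    have h6 : 2 / Real.pi * ‖s - t‖ = 2 * (‖s - t‖ / Real.pi) := by ring
    linarith
  have hk : ‖kernelFun (r * toCircle t) s‖ ^ 2 = (1 - r ^ 2) / D ^ 2 := by
    have h2 : kernelFun (r * toCircle t) s = ((Real.sqrt (1 - r ^ 2) : ℝ) : ℂ) / (1 - r * e) := by
      change ((Real.sqrt (1 - ‖(r : ℂ) * toCircle t‖ ^ 2) : ℝ) : ℂ) /
        (1 - conj ((r : ℂ) * toCircle t) * (toCircle s : ℂ)) = _
      have h3 : conj ((r : ℂ) * toCircle t) * (toCircle s : ℂ) = r * e := by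
        rw [he, sub_eq_add_neg, toCircle_add, toCircle_neg, Circle.coe_mul, Circle.coe_inv_eq_conj,
          map_mul, Complex.conj_ofReal]
        ring
      rw [norm_mul_toCircle h0, h3]
    rw [h2, norm_div, div_pow, Complex.norm_real, Real.norm_of_nonneg (Real.sqrt_nonneg _),
      Real.sq_sqrt (by nlinarith)]
  have hDpos : 0 < D := hδ.trans_le hD1
  have hk2 : ‖kernelFun (r * toCircle t) s‖ ^ 2 ≤ 2 * (1 - r) / D ^ 2 := by
    rw [hk]; gcongr; nlinarith
  have hex : ∃ k : ℕ, ‖s - t‖ ≤ 2 ^ k * (1 - r) := by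
    obtain ⟨k, hk⟩ := pow_unbounded_of_one_lt (‖s - t‖ / (1 - r)) (one_lt_two (α := ℝ))
    exact ⟨k, by rw [div_lt_iff₀ hδ] at hk; exact hk.le⟩
  refine ⟨Nat.find hex, Nat.find_spec hex, hk2.trans ?_⟩
  have hpi : 3 < Real.pi := Real.pi_gt_three
  rcases Nat.eq_zero_or_pos (Nat.find hex) with h | h
  · rw [h, pow_zero, one_mul, div_le_div_iff₀ (by positivity) hδ]
    have h3 : (1 - r) ^ 2 ≤ D ^ 2 := by gcongr
    have h4 : 1 ≤ Real.pi ^ 2 := by nlinarith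
    have h5 : D ^ 2 ≤ Real.pi ^ 2 * D ^ 2 := le_mul_of_one_le_left (sq_nonneg D) h4
    nlinarith [sq_nonneg D]
  · have hm := Nat.find_min hex (Nat.sub_lt h one_pos)
    obtain ⟨k, hkk⟩ : ∃ k, Nat.find hex = k + 1 := ⟨Nat.find hex - 1, by omega⟩
    rw [hkk, Nat.add_sub_cancel, not_le] at hm
    rw [hkk]
    have h2 : 2 ^ k * (1 - r) / Real.pi ≤ D := le_trans (by gcongr) hD2
    have h3 : (2 ^ k * (1 - r) / Real.pi) ^ 2 ≤ D ^ 2 := by gcongr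
    calc 2 * (1 - r) / D ^ 2 ≤ 2 * (1 - r) / (2 ^ k * (1 - r) / Real.pi) ^ 2 := by gcongr
      _ = 8 * Real.pi ^ 2 / (4 ^ (k + 1) * (1 - r)) := by
        have h4 : (4 : ℝ) ^ k = (2 ^ k) ^ 2 := by rw [← pow_mul, mul_comm, pow_mul]; norm_num
        rw [pow_succ (4 : ℝ), h4]
        field_simp
        ring

/-- Dominated convergence with a geometric majorant. It will be applied to the mean oscillation at a
Lebesgue point. -/
theorem tendsto_tsum_dyadic {a : ℝ → ℝ} {B c : ℝ} (ha : Tendsto a (𝓝[>] 0) (𝓝 0))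
    (hB : ∀ h, 0 < h → |a h| ≤ B) :
    Tendsto (fun δ => ∑' k : ℕ, c * (1 / 2) ^ k * a (2 ^ k * δ)) (𝓝[>] 0) (𝓝 0) := by
  have h := tendsto_tsum_of_dominated_convergence (𝓕 := 𝓝[>] (0 : ℝ))
    (f := fun δ (k : ℕ) => c * (1 / 2) ^ k * a (2 ^ k * δ)) (g := fun _ => 0)
    (bound := fun k : ℕ => |c| * (1 / 2) ^ k * B)
    ((summable_geometric_two.mul_left _).mul_right _) (fun k => ?_) ?_
  · simpa using h
  · have h1 : Tendsto (fun δ : ℝ => 2 ^ k * δ) (𝓝[>] 0) (𝓝[>] 0) := by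
      refine tendsto_nhdsWithin_iff.mpr ⟨?_, ?_⟩
      · have : Continuous fun δ : ℝ => 2 ^ k * δ := by fun_prop
        simpa using (this.tendsto 0).mono_left nhdsWithin_le_nhds
      · filter_upwards [self_mem_nhdsWithin] with δ hδ
        exact mul_pos (by positivity : (0 : ℝ) < 2 ^ k) hδ
    simpa using (ha.comp h1).const_mul (c * (1 / 2) ^ k)
  · filter_upwards [self_mem_nhdsWithin] with δ hδ k
    rw [norm_mul, norm_mul, Real.norm_eq_abs, Real.norm_eq_abs, Real.norm_eq_abs,
      abs_of_pos (by positivity : (0 : ℝ) < (1 / 2 : ℝ) ^ k)]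
    gcongr
    exact hB _ (mul_pos (by positivity : (0 : ℝ) < 2 ^ k) hδ)

theorem arcLength_le_volume : arcLength ≤ (volume : Measure Torus) := by
  rw [volume_eq_smul_haarAddCircle]
  refine Measure.le_iff.mpr fun s _ => ?_
  rw [Measure.smul_apply, smul_eq_mul]
  refine le_mul_of_one_le_left zero_le ?_
  rw [← ENNReal.ofReal_one]
  exact ENNReal.ofReal_le_ofReal (by linarith [Real.pi_gt_three])

theorem ae_volume_of_ae {p : Torus → Prop} (h : ∀ᵐ t ∂arcLength, p t) :
    ∀ᵐ t ∂(volume : Measure Torus), p t := by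
  rw [volume_eq_smul_haarAddCircle]
  exact Measure.ae_smul_measure h _

theorem ae_of_ae_volume {p : Torus → Prop} (h : ∀ᵐ t ∂(volume : Measure Torus), p t) :
    ∀ᵐ t ∂arcLength, p t := ae_mono arcLength_le_volume h

/-- The mean oscillation of `f` about the point `t`, at scale `h`. -/
def meanOsc (f : Linf) (t : Torus) (h : ℝ) : ℝ :=
  (∫ s in Metric.closedBall t h, ‖f s - f t‖) / (2 * h)

theorem integrable_linf (f : Linf) : Integrable f (volume : Measure Torus) :=
  memLp_one_iff_integrable.mp
    (MemLp.of_haarAddCircle ((Lp.memLp f).mono_exponent (by simp)))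

theorem meanOsc_nonneg (f : Linf) (t : Torus) {h : ℝ} (hh : 0 < h) : 0 ≤ meanOsc f t h :=
  div_nonneg (integral_nonneg fun _ => norm_nonneg _) (by positivity)

theorem volume_real_closedBall_le (t : Torus) {h : ℝ} (hh : 0 < h) :
    (volume : Measure Torus).real (Metric.closedBall t h) ≤ 2 * h := by
  rw [measureReal_def, AddCircle.volume_closedBall, ENNReal.toReal_ofReal]
  · exact min_le_right _ _
  · exact le_min Real.two_pi_pos.le (by positivity)

theorem volume_real_closedBall_pos (t : Torus) {h : ℝ} (hh : 0 < h) :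
    0 < (volume : Measure Torus).real (Metric.closedBall t h) := by
  rw [measureReal_def, AddCircle.volume_closedBall, ENNReal.toReal_ofReal]
  · exact lt_min Real.two_pi_pos (by positivity)
  · exact le_min Real.two_pi_pos.le (by positivity)

theorem meanOsc_le {f : Linf} {t : Torus} (ht : ‖f t‖ ≤ ‖f‖) {h : ℝ} (hh : 0 < h) :
    |meanOsc f t h| ≤ 2 * ‖f‖ := by
  rw [abs_of_nonneg (meanOsc_nonneg f t hh), meanOsc, div_le_iff₀ (by positivity)]
  have h1 : ‖∫ s in Metric.closedBall t h, ‖f s - f t‖‖ ≤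
      2 * ‖f‖ * (volume : Measure Torus).real (Metric.closedBall t h) := by
    refine norm_setIntegral_le_of_norm_le_const_ae' (measure_lt_top _ _) ?_
    filter_upwards [ae_volume_of_ae (linf_ae_norm_le f)] with s hs _
    rw [norm_norm]
    linarith [norm_sub_le (f s) (f t)]
  have h2 := volume_real_closedBall_le t hh
  refine (le_abs_self _).trans (h1.trans ?_)
  gcongr

/-- Almost every point is a Lebesgue point. A ball has measure `min (2π) (2h) ≤ 2h`, so dividing by
`2h` only lowers the average. -/
theorem tendsto_meanOsc (f : Linf) :
    ∀ᵐ t ∂arcLength, Tendsto (meanOsc f t) (𝓝[>] 0) (𝓝 0) := by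
  refine ae_of_ae_volume ?_
  filter_upwards [IsUnifLocDoublingMeasure.ae_tendsto_average_norm_sub
    (volume : Measure Torus) (integrable_linf f).locallyIntegrable 1] with t ht
  have h := ht (l := 𝓝[>] (0 : ℝ)) (fun _ => t) (fun h => h) tendsto_id (by
    filter_upwards [self_mem_nhdsWithin] with h hh
    exact Metric.mem_closedBall_self (by rw [one_mul]; exact le_of_lt hh))
  refine squeeze_zero' ?_ ?_ h
  · filter_upwards [self_mem_nhdsWithin] with h hh using meanOsc_nonneg f t hh
  · filter_upwards [self_mem_nhdsWithin] with h hh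
    rw [setAverage_eq, meanOsc, smul_eq_mul, div_eq_inv_mul]
    have := volume_real_closedBall_pos t hh
    gcongr
    exact volume_real_closedBall_le t hh

/-- The Poisson kernel is dominated by a sum of multiples of indicators of the balls of radius `2^k
(1 - r)`, which turns the error into a weighted sum of mean oscillations. -/
theorem norm_poisson_sub_le_tsum (f : Linf) (t : Torus) (hmeas : ‖f t‖ ≤ ‖f‖) {r : ℝ} (h0 : 0 ≤ r)
    (h1 : r < 1) :
    ‖inner ℂ (kernelPlus (r * toCircle t)) (mulOp f (kernelPlus (r * toCircle t))) - f t‖ ≤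
      ∑' k : ℕ, 16 * Real.pi ^ 2 * (1 / 2) ^ k * meanOsc f t (2 ^ k * (1 - r)) := by
  have hδ : 0 < 1 - r := by linarith
  set z : ℂ := r * toCircle t with hz
  have e1 : inner ℂ (kernelPlus z) (mulOp f (kernelPlus z)) - f t =
      ∫ s, (f s - f t) * ((‖kernelFun z s‖ ^ 2 : ℝ) : ℂ) ∂arcLength := by
    have h2 : inner ℂ (kernelPlus z) (mulOp (f t • (1 : Linf)) (kernelPlus z)) = f t := by
      rw [mulOp_smul, mulOp_one, smul_apply, one_apply_eq_self, inner_smul_right,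
        inner_self_eq_norm_sq_to_K, norm_kernelPlus h0 h1]
      simp
    have h3 : inner ℂ (kernelPlus z) (mulOp f (kernelPlus z)) - f t =
        inner ℂ (kernelPlus z) (mulOp (f - f t • (1 : Linf)) (kernelPlus z)) := by
      rw [mulOp_sub, sub_apply, inner_sub_right, h2]
    rw [h3, inner_mulOp_kernelPlus]
    apply integral_congr_ae
    filter_upwards [Lp.coeFn_sub f (f t • (1 : Linf)), Lp.coeFn_smul (f t) (1 : Linf), coeFn_one]
      with s h₁ h₂ h₃
    rw [h₁, Pi.sub_apply, h₂, Pi.smul_apply, h₃, smul_eq_mul, mul_one]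
  have hterm : ∀ k : ℕ, 0 ≤ 16 * Real.pi ^ 2 * (1 / 2) ^ k * meanOsc f t (2 ^ k * (1 - r)) :=
    fun k => mul_nonneg (by positivity) (meanOsc_nonneg f t (by positivity))
  have hsum : Summable fun k : ℕ =>
      16 * Real.pi ^ 2 * (1 / 2) ^ k * meanOsc f t (2 ^ k * (1 - r)) := by
    refine Summable.of_norm_bounded (g := fun k : ℕ => 16 * Real.pi ^ 2 * (1 / 2) ^ k * (2 * ‖f‖))
      ((summable_geometric_two.mul_left _).mul_right _) fun k => ?_
    rw [norm_mul, Real.norm_of_nonneg (by positivity)]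
    gcongr
    exact meanOsc_le hmeas (by positivity)
  have hfm : AEMeasurable (fun s => ‖f s - f t‖ₑ) (volume : Measure Torus) :=
    ((integrable_linf f).aestronglyMeasurable.sub aestronglyMeasurable_const).enorm
  have key : ‖inner ℂ (kernelPlus z) (mulOp f (kernelPlus z)) - f t‖ₑ ≤ ENNReal.ofReal
      (∑' k : ℕ, 16 * Real.pi ^ 2 * (1 / 2) ^ k * meanOsc f t (2 ^ k * (1 - r))) := by
    rw [e1]
    calc ‖∫ s, (f s - f t) * ((‖kernelFun z s‖ ^ 2 : ℝ) : ℂ) ∂arcLength‖ₑ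
        ≤ ∫⁻ s, ‖(f s - f t) * ((‖kernelFun z s‖ ^ 2 : ℝ) : ℂ)‖ₑ ∂arcLength :=
          enorm_integral_le_lintegral_enorm _
      _ ≤ ∫⁻ s, ‖(f s - f t) * ((‖kernelFun z s‖ ^ 2 : ℝ) : ℂ)‖ₑ :=
          lintegral_mono' arcLength_le_volume le_rfl
      _ ≤ ∫⁻ s, ∑' k : ℕ, (Metric.closedBall t (2 ^ k * (1 - r))).indicator (fun s =>
            ENNReal.ofReal (8 * Real.pi ^ 2 / (4 ^ k * (1 - r))) * ‖f s - f t‖ₑ) s := by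
          refine lintegral_mono fun s => ?_
          obtain ⟨k, hk1, hk2⟩ := norm_sq_kernelFun_le h0 h1 t s
          refine le_trans ?_ (ENNReal.le_tsum k)
          rw [Set.indicator_of_mem (by rwa [Metric.mem_closedBall, dist_eq_norm]), enorm_mul,
            mul_comm]
          gcongr
          rw [← ofReal_norm, Complex.norm_real, Real.norm_of_nonneg (by positivity)]
          exact ENNReal.ofReal_le_ofReal hk2
      _ = ∑' k : ℕ, ∫⁻ s, (Metric.closedBall t (2 ^ k * (1 - r))).indicator (fun s =>
            ENNReal.ofReal (8 * Real.pi ^ 2 / (4 ^ k * (1 - r))) * ‖f s - f t‖ₑ) s :=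
          lintegral_tsum fun k => (hfm.const_mul _).indicator measurableSet_closedBall
      -- With `δ = 1 - r`, the kernel bound `8π² / (4^k δ)` times the normalisation `2 · 2^k δ` of
      -- `meanOsc` is `16π² / 2^k`.
      _ = ∑' k : ℕ, ENNReal.ofReal
            (16 * Real.pi ^ 2 * (1 / 2) ^ k * meanOsc f t (2 ^ k * (1 - r))) := by
          refine tsum_congr fun k => ?_
          have hint : IntegrableOn (fun s => f s - f t)
              (Metric.closedBall t (2 ^ k * (1 - r))) volume :=
            ((integrable_linf f).sub (integrable_const _)).integrableOn
          rw [lintegral_indicator measurableSet_closedBall,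
            lintegral_const_mul' _ _ ENNReal.ofReal_ne_top,
            ← ofReal_integral_norm_eq_lintegral_enorm hint,
            ← ENNReal.ofReal_mul (by positivity)]
          congr 1
          rw [meanOsc]
          have h4 : (4 : ℝ) ^ k = 2 ^ k * 2 ^ k := by rw [← mul_pow]; norm_num
          rw [h4, one_div, inv_pow]
          field_simp
          ring
      _ = _ := (ENNReal.ofReal_tsum_of_nonneg hterm hsum).symm
  rw [← ofReal_norm] at key
  exact (ENNReal.ofReal_le_ofReal_iff (tsum_nonneg hterm)).mp key

/-- Fatou's theorem: the Poisson integral of a bounded function has radial limits almost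
everywhere. -/
theorem ae_tendsto_poisson (f : Linf) : ∀ᵐ t ∂arcLength, Tendsto
    (fun r : ℝ => inner ℂ (kernelPlus (r * toCircle t)) (mulOp f (kernelPlus (r * toCircle t))))
    (𝓝[<] 1) (𝓝 (f t)) := by
  filter_upwards [tendsto_meanOsc f, linf_ae_norm_le f] with t ht hft
  rw [tendsto_iff_norm_sub_tendsto_zero]
  have h1 : Tendsto (fun r : ℝ => 1 - r) (𝓝[<] 1) (𝓝[>] 0) := by
    refine tendsto_nhdsWithin_iff.mpr ⟨?_, ?_⟩
    · have : Continuous fun r : ℝ => 1 - r := by fun_prop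
      simpa using (this.tendsto 1).mono_left nhdsWithin_le_nhds
    · filter_upwards [self_mem_nhdsWithin] with r hr
      exact sub_pos.mpr (Set.mem_Iio.mp hr)
  have h2 := (tendsto_tsum_dyadic (c := 16 * Real.pi ^ 2) ht fun h hh => meanOsc_le hft hh).comp h1
  refine squeeze_zero' (Eventually.of_forall fun _ => norm_nonneg _) ?_ h2
  filter_upwards [eventually_mem_Ico] with r hr using norm_poisson_sub_le_tsum f t hft hr.1 hr.2

/-! ### Symbols modulo compact operators -/

theorem tendsto_inner_compact {u : ℝ → L2} (hu : ∀ᶠ r in 𝓝[<] (1 : ℝ), ‖u r‖ = 1) {K : BL2}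
    (hK : Tendsto (fun r => K (u r)) (𝓝[<] 1) (𝓝 0)) :
    Tendsto (fun r => inner ℂ (u r) (K (u r))) (𝓝[<] 1) (𝓝 0) := by
  refine squeeze_zero_norm' ?_ (by simpa using hK.norm)
  filter_upwards [hu] with r hr
  simpa [hr] using norm_inner_le_norm (𝕜 := ℂ) (u r) (K (u r))

theorem eventually_norm_mul_toCircle_lt (t : Torus) :
    ∀ᶠ r : ℝ in 𝓝[<] 1, ‖(r : ℂ) * toCircle t‖ < 1 := by
  filter_upwards [eventually_mem_Ico] with r hr
  rw [norm_mul_toCircle hr.1]; exact hr.2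

theorem eventually_norm_kernelPlus (t : Torus) :
    ∀ᶠ r : ℝ in 𝓝[<] 1, ‖kernelPlus (r * toCircle t)‖ = 1 := by
  filter_upwards [eventually_mem_Ico] with r hr using norm_kernelPlus hr.1 hr.2 t

theorem eventually_norm_kernelMinus (t : Torus) :
    ∀ᶠ r : ℝ in 𝓝[<] 1, ‖kernelMinus (r * toCircle t)‖ = 1 := by
  filter_upwards [eventually_mem_Ico] with r hr using norm_kernelMinus hr.1 hr.2 t

theorem tendsto_inner_kernelPlus {T : BL2} {f ψ : Linf} (h : T - diagOp f ψ ∈ compactSub) :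
    ∀ᵐ t ∂arcLength, Tendsto (fun r : ℝ =>
      inner ℂ (kernelPlus (r * toCircle t)) (T (kernelPlus (r * toCircle t))))
      (𝓝[<] 1) (𝓝 (f t)) := by
  filter_upwards [ae_tendsto_poisson f] with t ht
  have hK := tendsto_inner_compact (eventually_norm_kernelPlus t) (tendsto_compact_kernelPlus h t)
  have hs := hK.add ht
  rw [zero_add] at hs
  refine hs.congr' ?_
  filter_upwards [eventually_norm_mul_toCircle_lt t] with r hr
  rw [← inner_diagOp_kernelPlus hr f ψ, ← inner_add_right, sub_apply, sub_add_cancel]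

theorem tendsto_inner_kernelMinus {T : BL2} {f ψ : Linf} (h : T - diagOp f ψ ∈ compactSub) :
    ∀ᵐ t ∂arcLength, Tendsto (fun r : ℝ =>
      inner ℂ (kernelMinus (r * toCircle t)) (T (kernelMinus (r * toCircle t))))
      (𝓝[<] 1) (𝓝 (ψ t)) := by
  filter_upwards [ae_tendsto_poisson ψ] with t ht
  have hK := tendsto_inner_compact (eventually_norm_kernelMinus t)
    (tendsto_compact_kernelMinus h t)
  have hs := hK.add ht
  rw [zero_add] at hs
  refine hs.congr' ?_
  filter_upwards [eventually_norm_mul_toCircle_lt t] with r hr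
  rw [← inner_mulOp_kernelMinus, ← inner_diagOp_kernelMinus hr f ψ, ← inner_add_right, sub_apply,
    sub_add_cancel]

theorem norm_inner_apply_le {x : L2} (hx : ‖x‖ = 1) (T : BL2) : ‖inner ℂ x (T x)‖ ≤ ‖T‖ := by
  refine (norm_inner_le_norm _ _).trans ?_
  simpa [hx] using T.le_opNorm x

/-- Almost every value of `f` and `ψ` is a limit of quadratic forms of `T` at unit vectors, each
bounded by `‖T‖`. -/
theorem max_norm_le_of_compact {T : BL2} {f ψ : Linf} (h : T - diagOp f ψ ∈ compactSub) :
    max ‖f‖ ‖ψ‖ ≤ ‖T‖ := by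
  refine max_le (linf_norm_le_of_ae (norm_nonneg _) ?_) (linf_norm_le_of_ae (norm_nonneg _) ?_)
  · filter_upwards [tendsto_inner_kernelPlus h] with t ht
    refine le_of_tendsto ht.norm ?_
    filter_upwards [eventually_norm_kernelPlus t] with r hr using norm_inner_apply_le hr T
  · filter_upwards [tendsto_inner_kernelMinus h] with t ht
    refine le_of_tendsto ht.norm ?_
    filter_upwards [eventually_norm_kernelMinus t] with r hr using norm_inner_apply_le hr T

/-- The essential norm of a compact perturbation of `P₊ f P₊ + P₋ ψ P₋`. -/
theorem essNorm_eq_max {T : BL2} {f ψ : Linf} (h : T - diagOp f ψ ∈ compactSub) :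
    max ‖f‖ ‖ψ‖ = essNorm T := by
  apply le_antisymm
  · refine (Metric.le_infDist ⟨0, zero_mem compactSub⟩).mpr fun K hK => ?_
    rw [dist_eq_norm]
    refine max_norm_le_of_compact ?_
    rw [sub_right_comm]
    exact sub_mem h (show K ∈ compactSub from hK)
  -- The compact operator `T - diagOp f ψ` is itself an optimal approximant.
  · refine (Metric.infDist_le_dist_of_mem (x := T) (show _ ∈ compactOps from h)).trans ?_
    rw [dist_eq_norm, sub_sub_cancel]
    exact norm_diagOp_le f ψ

/-- `T` is a compact perturbation of `P₊ f P₊ + P₋ ψ P₋`, with `f` and `ψ` quasicontinuous. -/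
structure HasSymbol (T : BL2) (f ψ : Linf) : Prop where
  fst_mem : f ∈ QC
  snd_mem : ψ ∈ QC
  compact : T - diagOp f ψ ∈ compactSub

/-- Symbols depend contractively on the operator; this yields both their uniqueness and their
convergence along norm limits. -/
theorem HasSymbol.max_norm_sub_le {S T : BL2} {f ψ g φ : Linf} (hS : HasSymbol S f ψ)
    (hT : HasSymbol T g φ) : max ‖f - g‖ ‖ψ - φ‖ ≤ ‖S - T‖ := by
  refine max_norm_le_of_compact ?_
  rw [diagOp_sub, sub_sub_sub_comm]
  exact sub_mem hS.compact hT.compact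

theorem HasSymbol.unique {T : BL2} {f ψ g φ : Linf} (h : HasSymbol T f ψ)
    (h' : HasSymbol T g φ) : f = g ∧ ψ = φ := by
  have := h.max_norm_sub_le h'
  rw [sub_self, norm_zero, max_le_iff, norm_le_zero_iff, norm_le_zero_iff, sub_eq_zero,
    sub_eq_zero] at this
  exact this

theorem hasSymbol_diagOp {f ψ : Linf} (hf : f ∈ QC) (hψ : ψ ∈ QC) :
    HasSymbol (diagOp f ψ) f ψ := ⟨hf, hψ, by rw [sub_self]; exact zero_mem _⟩

theorem hasSymbol_gsio {f φ g ψ : Linf} (hf : f ∈ QC) (hφ : φ ∈ QC) (hg : g ∈ QC) (hψ : ψ ∈ QC) :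
    HasSymbol (gsio !![f, φ; g, ψ]) f ψ := ⟨hf, hψ, gsio_sub_diagOp_mem hφ hg⟩

theorem hasSymbol_smul_one (c : ℂ) : HasSymbol (c • 1) (c • 1) (c • 1) :=
  ⟨contFun_subset_QC (const_mem_contFun c), contFun_subset_QC (const_mem_contFun c), by
    rw [diagOp_smul_one, sub_self]; exact zero_mem _⟩

theorem hasSymbol_one : HasSymbol 1 1 1 := by
  simpa using hasSymbol_smul_one 1

theorem hasSymbol_zero_iff {T : BL2} : HasSymbol T 0 0 ↔ T ∈ compactSub := by
  have h0 : (0 : Linf) ∈ QC := zero_mem qcAlg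
  have hd : diagOp 0 0 = 0 := by simpa using diagOp_smul_one 0
  exact ⟨fun h => by simpa [hd] using h.compact, fun h => ⟨h0, h0, by rwa [hd, sub_zero]⟩⟩

theorem HasSymbol.add {S T : BL2} {f ψ g φ : Linf} (hS : HasSymbol S f ψ)
    (hT : HasSymbol T g φ) : HasSymbol (S + T) (f + g) (ψ + φ) :=
  ⟨add_mem (s := qcAlg) hS.fst_mem hT.fst_mem, add_mem (s := qcAlg) hS.snd_mem hT.snd_mem, by
    rw [diagOp_add, add_sub_add_comm]; exact add_mem hS.compact hT.compact⟩

theorem HasSymbol.sub {S T : BL2} {f ψ g φ : Linf} (hS : HasSymbol S f ψ)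
    (hT : HasSymbol T g φ) : HasSymbol (S - T) (f - g) (ψ - φ) :=
  ⟨sub_mem_QC hS.fst_mem hT.fst_mem, sub_mem_QC hS.snd_mem hT.snd_mem, by
    rw [diagOp_sub, sub_sub_sub_comm]; exact sub_mem hS.compact hT.compact⟩

theorem HasSymbol.mul {S T : BL2} {f ψ g φ : Linf} (hS : HasSymbol S f ψ)
    (hT : HasSymbol T g φ) : HasSymbol (S * T) (f * g) (ψ * φ) := by
  refine ⟨mul_mem (s := qcAlg) hS.fst_mem hT.fst_mem, mul_mem (s := qcAlg) hS.snd_mem hT.snd_mem,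
    ?_⟩
  have h : S * T - diagOp (f * g) (ψ * φ) = (S - diagOp f ψ) * T +
      diagOp f ψ * (T - diagOp g φ) +
      (diagOp f ψ * diagOp g φ - diagOp (f * g) (ψ * φ)) := by noncomm_ring
  rw [h]
  exact add_mem (add_mem (mul_mem_compactSub_right hS.compact _)
    (mul_mem_compactSub_left _ hT.compact)) (diagOp_mul_sub_mem hT.fst_mem hT.snd_mem)

theorem HasSymbol.star {T : BL2} {f ψ : Linf} (hT : HasSymbol T f ψ) :
    HasSymbol (star T) (star f) (star ψ) :=
  ⟨star_mem_QC hT.fst_mem, star_mem_QC hT.snd_mem, by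
    rw [← star_diagOp, ← star_sub]; exact star_mem_compactSub hT.compact⟩

/-- The operators that have a symbol, as a subsemiring. -/
def symbolSubsemiring : Subsemiring BL2 where
  carrier := {T | ∃ f ψ, HasSymbol T f ψ}
  mul_mem' := fun ⟨_, _, ha⟩ ⟨_, _, hb⟩ => ⟨_, _, ha.mul hb⟩
  one_mem' := ⟨_, _, hasSymbol_one⟩
  add_mem' := fun ⟨_, _, ha⟩ ⟨_, _, hb⟩ => ⟨_, _, ha.add hb⟩
  zero_mem' := ⟨0, 0, hasSymbol_zero_iff.mpr (zero_mem _)⟩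

theorem cauchySeq_of_norm_sub_le {E F : Type*} [SeminormedAddCommGroup E]
    [SeminormedAddCommGroup F] {u : ℕ → E} {v : ℕ → F} (hv : CauchySeq v)
    (h : ∀ m n, ‖u m - u n‖ ≤ ‖v m - v n‖) : CauchySeq u := by
  rw [Metric.cauchySeq_iff] at *
  intro ε hε
  obtain ⟨N, hN⟩ := hv ε hε
  refine ⟨N, fun m hm n hn => ?_⟩
  have := hN m hm n hn
  rw [dist_eq_norm] at *
  exact (h m n).trans_lt this

/-- Symbols of a convergent sequence are Cauchy in the complete space `L^∞`; `QC` and the compact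
operators are closed, so the limits form a symbol of the limit operator. -/
theorem isClosed_symbolSubsemiring : IsClosed (symbolSubsemiring : Set BL2) := by
  refine isClosed_of_closure_subset fun T hT => ?_
  obtain ⟨S, hS, hST⟩ := mem_closure_iff_seq_limit.mp hT
  choose f ψ h using hS
  have hf : CauchySeq f := cauchySeq_of_norm_sub_le hST.cauchySeq fun m n =>
    (le_max_left _ _).trans ((h m).max_norm_sub_le (h n))
  have hψ : CauchySeq ψ := cauchySeq_of_norm_sub_le hST.cauchySeq fun m n =>
    (le_max_right _ _).trans ((h m).max_norm_sub_le (h n))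
  obtain ⟨g, hg⟩ := cauchySeq_tendsto_of_complete hf
  obtain ⟨φ, hφ⟩ := cauchySeq_tendsto_of_complete hψ
  have h1 : Tendsto (fun n => mulOp (f n)) atTop (𝓝 (mulOp g)) :=
    (mulOpL.continuous.tendsto g).comp hg
  have h2 : Tendsto (fun n => mulOp (ψ n)) atTop (𝓝 (mulOp φ)) :=
    (mulOpL.continuous.tendsto φ).comp hφ
  have h3 : Tendsto (fun n => S n - diagOp (f n) (ψ n)) atTop (𝓝 (T - diagOp g φ)) :=
    hST.sub (((h1.const_mul Pplus).mul_const Pplus).add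
      ((h2.const_mul Pminus).mul_const Pminus))
  exact ⟨g, φ, isClosed_QC.mem_of_tendsto hg (Eventually.of_forall fun n => (h n).fst_mem),
    isClosed_QC.mem_of_tendsto hφ (Eventually.of_forall fun n => (h n).snd_mem),
    isClosed_compactSub.mem_of_tendsto h3 (Eventually.of_forall fun n => (h n).compact)⟩

theorem exists_hasSymbol {T : BL2} (hT : T ∈ algQC) : ∃ f ψ, HasSymbol T f ψ := by
  have hle : (Subsemiring.closure gsioQC).topologicalClosure ≤ symbolSubsemiring := by
    refine Subsemiring.topologicalClosure_minimal _ (Subsemiring.closure_le.mpr ?_)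
      isClosed_symbolSubsemiring
    rintro _ ⟨H, hH, rfl⟩
    rw [Matrix.eta_fin_two H]
    exact ⟨_, _, hasSymbol_gsio (hH _ _) (hH _ _) (hH _ _) (hH _ _)⟩
  exact hle hT

/-! ### The algebra contains the compact operators -/

theorem gsio_mem_algQC {f φ g ψ : Linf} (hf : f ∈ QC) (hφ : φ ∈ QC) (hg : g ∈ QC) (hψ : ψ ∈ QC) :
    gsio !![f, φ; g, ψ] ∈ algQC := by
  refine subset_closure (Subsemiring.subset_closure ⟨_, fun i j => ?_, rfl⟩)
  fin_cases i <;> fin_cases j <;> assumption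

theorem diagOp_mem_algQC {f ψ : Linf} (hf : f ∈ QC) (hψ : ψ ∈ QC) : diagOp f ψ ∈ algQC := by
  have h0 : (0 : Linf) ∈ QC := zero_mem qcAlg
  have h := gsio_mem_algQC hf h0 h0 hψ
  simpa [gsio, diagOp, mulOp_zero] using h

theorem Pplus_mem_algQC : Pplus ∈ algQC := by
  have h := diagOp_mem_algQC (one_mem qcAlg) (zero_mem qcAlg)
  simpa [diagOp, mulOp_zero, mulOp_one, Pplus_mul_Pplus] using h

/-- With all four entries equal to `f`, the blocks reassemble to multiplication by `f`. -/
theorem mulOp_mem_algQC {f : Linf} (hf : f ∈ QC) : mulOp f ∈ algQC := by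
  have h := gsio_mem_algQC hf hf hf hf
  have h1 : gsio !![f, f; f, f] = (Pplus + Pminus) * mulOp f * (Pplus + Pminus) := by
    simp only [gsio, Matrix.of_apply, Matrix.cons_val', Matrix.cons_val_zero, Matrix.cons_val_one,
      Matrix.cons_val_fin_one, mul_add, add_mul]
    abel
  rwa [h1, Pplus_add_Pminus, one_mul, mul_one] at h

/-- `P₊ - e^{iθ} P₊ e^{-iθ}` is the projection onto the constants; multiplying by exponentials on
both sides gives every matrix unit. -/
theorem matUnit_mem_algQC (n m : ℤ) : matUnit n m ∈ algQC := by
  have he : ∀ k, mulOp (expInf k) ∈ algQC := fun k =>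
    mulOp_mem_algQC (contFun_subset_QC (expInf_mem_contFun k))
  have h0 : matUnit 0 0 = Pplus - mulOp (expInf 1) * Pplus * mulOp (expInf (-1)) := by
    refine op_ext fun j => ?_
    rw [sub_apply, mul_apply_eq_comp, mul_apply_eq_comp, mulOp_expInf, Pplus_expL2, Pplus_expL2,
      matUnit_apply, inner_expL2]
    rcases lt_trichotomy j 0 with h | h | h
    · rw [if_neg (by omega), if_neg (by omega), if_neg (by omega)]; simp
    · subst h; simp
    · rw [if_neg (by omega), if_pos (by omega), if_pos (by omega), mulOp_expInf]; simp
  have h1 : matUnit n m = mulOp (expInf n) * matUnit 0 0 * mulOp (expInf (-m)) := by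
    refine op_ext fun j => ?_
    rw [mul_apply_eq_comp, mul_apply_eq_comp, mulOp_expInf, matUnit_apply, matUnit_apply,
      inner_expL2, inner_expL2, map_smul, mulOp_expInf, add_zero]
    congr 2
    exact propext ⟨fun h => by omega, fun h => by omega⟩
  rw [h1, h0]
  exact mul_mem (mul_mem (he n) (sub_mem Pplus_mem_algQC
    (mul_mem (mul_mem (he 1) Pplus_mem_algQC) (he (-1))))) (he (-m))

theorem compactOps_subset_algQC : compactOps ⊆ (algQC : Set BL2) := by
  have hcl : IsClosed ((Subalgebra.toSubmodule algQC.toSubalgebra : Submodule ℂ BL2) : Set BL2) :=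
    Subsemiring.isClosed_topologicalClosure (Subsemiring.closure gsioQC)
  exact fun K hK => compactSub_le_of_matUnit_mem hcl matUnit_mem_algQC hK

/-! ### The symbol homomorphism -/

/-- The first component of the symbol. -/
def symbolFst (T : algQC) : Linf := (exists_hasSymbol T.2).choose

/-- The second component of the symbol. -/
def symbolSnd (T : algQC) : Linf := (exists_hasSymbol T.2).choose_spec.choose

theorem hasSymbol_symbol (T : algQC) : HasSymbol T (symbolFst T) (symbolSnd T) :=
  (exists_hasSymbol T.2).choose_spec.choose_spec

/-- By uniqueness the choice of symbol is immaterial, and each homomorphism identity reduces to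
exhibiting one symbol. -/
theorem symbol_eq {T : algQC} {f ψ : Linf} (h : HasSymbol T f ψ) :
    (symbolFst T, symbolSnd T) = (f, ψ) :=
  Prod.ext_iff.mpr ((hasSymbol_symbol T).unique h)

/-- The symbol homomorphism. -/
def symbolHom : algQC →⋆ₐ[ℂ] Linf × Linf where
  toFun T := (symbolFst T, symbolSnd T)
  map_one' := symbol_eq hasSymbol_one
  map_mul' S T := symbol_eq ((hasSymbol_symbol S).mul (hasSymbol_symbol T))
  map_zero' := symbol_eq (hasSymbol_zero_iff.mpr (zero_mem _))
  map_add' S T := symbol_eq ((hasSymbol_symbol S).add (hasSymbol_symbol T))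
  commutes' c := by
    refine symbol_eq ?_
    rw [Algebra.algebraMap_eq_smul_one]
    exact hasSymbol_smul_one c
  map_star' T := symbol_eq (hasSymbol_symbol T).star

theorem symbolHom_apply (T : algQC) : symbolHom T = (symbolFst T, symbolSnd T) := rfl

theorem symbolHom_eq_zero_iff (T : algQC) : symbolHom T = 0 ↔ (T : BL2) ∈ compactOps := by
  refine ⟨fun h => ?_, fun h => symbol_eq (hasSymbol_zero_iff.mpr h)⟩
  have hT := hasSymbol_symbol T
  rw [symbolHom_apply, Prod.mk_eq_zero] at h
  rw [h.1, h.2] at hT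
  exact hasSymbol_zero_iff.mp hT

theorem range_symbolHom : Set.range symbolHom = QC ×ˢ QC := by
  ext ⟨f, ψ⟩
  constructor
  · rintro ⟨T, hT⟩
    rw [symbolHom_apply, Prod.mk.injEq] at hT
    rw [← hT.1, ← hT.2]
    exact ⟨(hasSymbol_symbol T).fst_mem, (hasSymbol_symbol T).snd_mem⟩
  · rintro ⟨hf, hψ⟩
    exact ⟨⟨diagOp f ψ, diagOp_mem_algQC hf hψ⟩, symbol_eq (hasSymbol_diagOp hf hψ)⟩

/-! ### Fredholm operators and the essential spectrum -/

theorem inner_mulOp_star_mul_self (f : Linf) (x : L2) :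
    inner ℂ x (mulOp (star f * f) x) = ((‖mulOp f x‖ ^ 2 : ℝ) : ℂ) := by
  rw [mulOp_mul, mul_apply_eq_comp, ← star_mulOp, ContinuousLinearMap.star_eq_adjoint,
    ContinuousLinearMap.adjoint_inner_right, inner_self_eq_norm_sq_to_K]
  norm_cast

/-- The square `‖f k_z‖²` is the Poisson integral of `|f|²`, to which Fatou's theorem applies. -/
theorem tendsto_norm_mulOp_kernelPlus (f : Linf) : ∀ᵐ t ∂arcLength, Tendsto
    (fun r : ℝ => ‖mulOp f (kernelPlus (r * toCircle t))‖) (𝓝[<] 1) (𝓝 ‖f t‖) := by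
  filter_upwards [ae_tendsto_poisson (star f * f), coeFn_mul (star f) f, coeFn_star f]
    with t h₁ h₂ h₃
  simp only [inner_mulOp_star_mul_self] at h₁
  rw [h₂, h₃, RCLike.conj_mul] at h₁
  have h4 := (Complex.continuous_re.tendsto _).comp h₁
  have h5 : Tendsto (fun r : ℝ => ‖mulOp f (kernelPlus (r * toCircle t))‖ ^ 2) (𝓝[<] 1)
      (𝓝 (‖f t‖ ^ 2)) := by
    refine (h4.congr fun r => ?_).trans (le_of_eq ?_)
    · simp only [Function.comp_apply, Complex.ofReal_re]
    · norm_cast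
  have h6 := (Real.continuous_sqrt.tendsto _).comp h5
  rw [Real.sqrt_sq (norm_nonneg _)] at h6
  refine h6.congr fun r => ?_
  simp only [Function.comp_apply, Real.sqrt_sq (norm_nonneg _)]

theorem norm_mulOp_kernelMinus (f : Linf) (z : ℂ) :
    ‖mulOp f (kernelMinus z)‖ = ‖mulOp f (kernelPlus z)‖ := by
  have h := inner_mulOp_kernelMinus (star f * f) z
  rw [inner_mulOp_star_mul_self, inner_mulOp_star_mul_self] at h
  exact (sq_eq_sq₀ (norm_nonneg _) (norm_nonneg _)).mp (by exact_mod_cast h)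

/-- Up to null terms, `u ≈ B T u ≈ B D u`, so `1 ≤ ‖B‖ a` in the limit. The `+ 1` keeps the bound
positive without discussing `B = 0`. -/
theorem le_norm_of_left_inverse {T B D : BL2} (hD : T - D ∈ compactSub)
    (hB : B * T - 1 ∈ compactSub) {u : ℝ → L2} (hu : ∀ᶠ r in 𝓝[<] (1 : ℝ), ‖u r‖ = 1)
    (hK : ∀ K ∈ compactSub, Tendsto (fun r => K (u r)) (𝓝[<] 1) (𝓝 0)) {v : ℝ → L2}
    (hv : ∀ᶠ r in 𝓝[<] (1 : ℝ), ‖D (u r)‖ ≤ ‖v r‖) {a : ℝ}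
    (ha : Tendsto (fun r => ‖v r‖) (𝓝[<] 1) (𝓝 a)) : (‖B‖ + 1)⁻¹ ≤ a := by
  have ha0 : 0 ≤ a := ge_of_tendsto' ha fun _ => norm_nonneg _
  have hlim : Tendsto (fun r => ‖B‖ * (‖(T - D) (u r)‖ + ‖v r‖) + ‖(B * T - 1) (u r)‖) (𝓝[<] 1)
      (𝓝 (‖B‖ * (0 + a) + 0)) := by
    have h1 := (hK _ hD).norm
    have h2 := (hK _ hB).norm
    rw [norm_zero] at h1 h2
    exact ((h1.add ha).const_mul ‖B‖).add h2
  have h1 : 1 ≤ ‖B‖ * (0 + a) + 0 := by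
    refine ge_of_tendsto hlim ?_
    filter_upwards [hu, hv] with r hr hvr
    have h2 : u r = B ((T - D) (u r) + D (u r)) - (B * T - 1) (u r) := by
      rw [sub_apply, sub_add_cancel, sub_apply, mul_apply_eq_comp, one_apply_eq_self,
        sub_sub_cancel]
    have h3 := norm_sub_le (B ((T - D) (u r) + D (u r))) ((B * T - 1) (u r))
    rw [← h2, hr] at h3
    have h4 := B.le_opNorm ((T - D) (u r) + D (u r))
    have h5 : ‖(T - D) (u r) + D (u r)‖ ≤ ‖(T - D) (u r)‖ + ‖v r‖ :=
      (norm_add_le _ _).trans (by gcongr)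
    have h6 : ‖B‖ * ‖(T - D) (u r) + D (u r)‖ ≤ ‖B‖ * (‖(T - D) (u r)‖ + ‖v r‖) := by gcongr
    linarith
  rw [inv_le_iff_one_le_mul₀ (by positivity)]
  nlinarith

/-- Fredholmness of a compact perturbation of `P₊ f P₊ + P₋ ψ P₋`. -/
theorem HasSymbol.isFredholm_iff {T : BL2} {f ψ : Linf} (h : HasSymbol T f ψ) :
    T.IsFredholm ↔ InvertibleInQC f ∧ InvertibleInQC ψ := by
  constructor
  · intro hT
    obtain ⟨B, hB⟩ := exists_left_inverse_mod_compact hT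
    have hpos : 0 < (‖B‖ + 1)⁻¹ := by positivity
    constructor
    · refine invertibleInQC_of_le h.fst_mem hpos ?_
      filter_upwards [tendsto_norm_mulOp_kernelPlus f] with t ht
      refine le_norm_of_left_inverse h.compact hB (eventually_norm_kernelPlus t)
        (fun K hK => tendsto_compact_kernelPlus hK t) ?_ ht
      filter_upwards [eventually_norm_mul_toCircle_lt t] with r hr
        using norm_diagOp_kernelPlus_le hr f ψ
    · refine invertibleInQC_of_le h.snd_mem hpos ?_
      filter_upwards [tendsto_norm_mulOp_kernelPlus ψ] with t ht
      refine le_norm_of_left_inverse h.compact hB (eventually_norm_kernelMinus t)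
        (fun K hK => tendsto_compact_kernelMinus hK t) ?_ ht
      filter_upwards [eventually_norm_mul_toCircle_lt t] with r hr
      rw [← norm_mulOp_kernelMinus]
      exact norm_diagOp_kernelMinus_le hr f ψ
  -- The inverse modulo compacts is `diagOp` of the inverse symbols: both products minus the
  -- identity have symbol zero.
  · rintro ⟨⟨-, g, hg, hfg⟩, ⟨-, φ, hφ, hψφ⟩⟩
    have hB := hasSymbol_diagOp hg hφ
    have h1 : HasSymbol (T * diagOp g φ - 1) 0 0 := by
      simpa [hfg, hψφ] using (h.mul hB).sub hasSymbol_one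
    have h2 : HasSymbol (diagOp g φ * T - 1) 0 0 := by
      simpa [mul_comm g f, mul_comm φ ψ, hfg, hψφ] using (hB.mul h).sub hasSymbol_one
    exact isFredholm_of_inverse_mod_compact (hasSymbol_zero_iff.mp h1) (hasSymbol_zero_iff.mp h2)

theorem coeFn_sub_smul_one (f : Linf) (z : ℂ) :
    ⇑(f - z • (1 : Linf)) =ᵐ[arcLength] fun t => f t - z := by
  filter_upwards [Lp.coeFn_sub f (z • (1 : Linf)), Lp.coeFn_smul z (1 : Linf), coeFn_one]
    with t h₁ h₂ h₃
  rw [h₁, Pi.sub_apply, h₂, Pi.smul_apply, h₃, smul_eq_mul, mul_one]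

theorem notMem_essRange_iff {f : Linf} {z : ℂ} :
    z ∉ essRange f ↔ ∃ ε : ℝ, 0 < ε ∧ ∀ᵐ t ∂arcLength, ε ≤ ‖f t - z‖ := by
  simp only [essRange, Set.mem_ofPred_eq, not_forall, not_lt, nonpos_iff_eq_zero, exists_prop,
    ae_iff, not_le]

/-- Lying outside the essential range means that `f - z` is bounded below almost everywhere, which
for quasicontinuous functions is invertibility in `QC`. -/
theorem invertibleInQC_sub_iff {f : Linf} (hf : f ∈ QC) (z : ℂ) :
    InvertibleInQC (f - z • (1 : Linf)) ↔ z ∉ essRange f := by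
  rw [notMem_essRange_iff]
  constructor
  · rintro ⟨-, h, -, hh⟩
    obtain ⟨δ, hδ, hle⟩ := exists_le_of_mul_eq_one hh
    refine ⟨δ, hδ, ?_⟩
    filter_upwards [hle, coeFn_sub_smul_one f z] with t h₁ h₂
    rwa [h₂] at h₁
  · rintro ⟨ε, hε, hle⟩
    refine invertibleInQC_of_le (sub_mem_QC hf
      (contFun_subset_QC (const_mem_contFun z))) hε ?_
    filter_upwards [hle, coeFn_sub_smul_one f z] with t h₁ h₂
    rwa [h₂]

theorem HasSymbol.essSpectrum_eq {T : BL2} {f ψ : Linf} (h : HasSymbol T f ψ) :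
    essSpectrum T = essRange f ∪ essRange ψ := by
  ext z
  change ¬ (T - z • (1 : BL2)).IsFredholm ↔ _
  rw [(h.sub (hasSymbol_smul_one z)).isFredholm_iff, invertibleInQC_sub_iff h.fst_mem,
    invertibleInQC_sub_iff h.snd_mem, ← not_or, not_not]
  rfl

end GSIO

end

/-- For symbols with quasicontinuous entries: the symbol map is a star homomorphism that gives the
exact sequence `0 → 𝒦 → 𝔯_QC → QC × QC → 0` and computes the essential norm; the essential spectrum
of `R_H` is the union of the essential ranges of `f` and `ψ`; and `R_H` is Fredholm iff `f` and `ψ`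
are invertible in `QC`. -/
theorem mainTheorem7 :
    (∃ ρ : GSIO.algQC →⋆ₐ[ℂ] GSIO.Linf × GSIO.Linf,
      GSIO.IsSymbolMap ρ ∧
      GSIO.compactOps ⊆ (GSIO.algQC : Set GSIO.BL2) ∧
      (∀ T : GSIO.algQC, ρ T = 0 ↔ (T : GSIO.BL2) ∈ GSIO.compactOps) ∧
      Set.range ρ = GSIO.QC ×ˢ GSIO.QC ∧
      (∀ T : GSIO.algQC, ‖ρ T‖ = GSIO.essNorm (T : GSIO.BL2))) ∧
    (∀ f ∈ GSIO.QC, ∀ g ∈ GSIO.QC, ∀ φ ∈ GSIO.QC, ∀ ψ ∈ GSIO.QC,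
      max ‖f‖ ‖ψ‖ = GSIO.essNorm (GSIO.gsio !![f, φ; g, ψ]) ∧
      GSIO.essSpectrum (GSIO.gsio !![f, φ; g, ψ]) = GSIO.essRange f ∪ GSIO.essRange ψ ∧
      ((GSIO.gsio !![f, φ; g, ψ]).IsFredholm ↔
        GSIO.InvertibleInQC f ∧ GSIO.InvertibleInQC ψ)) := by
  refine ⟨⟨GSIO.symbolHom, fun T => ⟨?_, ?_⟩, GSIO.compactOps_subset_algQC,
    GSIO.symbolHom_eq_zero_iff, GSIO.range_symbolHom, fun T => ?_⟩, fun f hf g hg φ hφ ψ hψ => ?_⟩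
  · exact GSIO.tendsto_inner_kernelPlus (GSIO.hasSymbol_symbol T).compact
  · exact GSIO.tendsto_inner_kernelMinus (GSIO.hasSymbol_symbol T).compact
  · exact GSIO.essNorm_eq_max (GSIO.hasSymbol_symbol T).compact
  · have h := GSIO.hasSymbol_gsio hf hφ hg hψ
    exact ⟨GSIO.essNorm_eq_max h.compact, h.essSpectrum_eq, h.isFredholm_iff⟩
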